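/- Let $N\ge 3$, $T\ge 0$ be integers and $\mathbb F_q$ a finite field. Consider the cyclic network with $N$ users and $N$ relays, in which user $i$ is connected to relays $i$ and $i-1$ (modulo $N$), so that $n=m=2$; let $\mathcal H_i$ be the set of relays connected to user $i$ and $\mathcal U_j$ the set of users connected to relay $j$. A scheme consists of an integer $L\ge1$ and random variables on one probability space: inputs $W_1,\dots,W_N$, independent and uniform on $\mathbb F_q^L$; keys $Z_1,\dots,Z_N\in\mathbb F_q^{L_Z}$, jointly independent of $(W_1,\dots,W_N)$ and derived from a source key $Z_\Sigma$, a string of symbols of $\mathbb F_q$ with $H(Z_1,\dots,Z_N\mid Z_\Sigma)=0$; messages $X_{i,j}$ ($j\in\mathcal H_i$) and $Y_j$ with finite alphabets such that $H(\{X_{i,j}\}_{j\in\mathcal H_i}\mid W_i,Z_i)=0$ and $H(Y_j\mid\{X_{i,j}\}_{i\in\mathcal U_j})=0$. Entropies are in base $q$. The scheme is $(0,1,T)$-secure if $H(\sum_i W_i\mid Y_1,\dots,Y_N)=0$ and, for every set $\mathcal T_h$ of at most one relay and every set $\mathcal T_u$ of at most $T$ users, $$I\bigl(W_1,\dots,W_N;\{X_{i,j}:i\in\mathcal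 U_j\}_{j\in\mathcal T_h}\bigm|\{W_i,Z_i\}_{i\in\mathcal T_u}\bigr)=0 .$$ Put $R_X=\max_{i,\,j\in\mathcal H_i}H(X_{i,j})/L$, $R_Y=\max_jH(Y_j)/L$, $R_Z=L_Z/L$, and $R_{Z_\Sigma}=L_{Z_\Sigma}/L$ with $L_{Z_\Sigma}=H(Z_1,\dots,Z_N)$. Every $(0,1,T)$-secure scheme has $R_X\ge\frac12$ and $R_Y\ge\frac12$; call it communication-optimal if $R_X=R_Y=\frac12$. Say that $(r,r')$ are the optimal key rates if every communication-optimal $(0,1,T)$-secure scheme over $\mathbb F_q$ has $R_Z\ge r$ and $R_{Z_\Sigma}\ge r'$, and some such scheme, with a source key of exactly $L_{Z_\Sigma}$ symbols, has both $R_Z=r$ and $R_{Z_\Sigma}=r'$. Then: - if $T\le N-3$, the optimal key rates are $R_Z=\frac12$ and $R_{Z_\Sigma}=\frac T2+1$; - if $T=N-2$, the optimal key rates are $R_Z=1$ and $R_{Z_\Sigma}=N-1$; - if $T\ge N-1$, there is no communication-optimal $(0,1,T)$-secure scheme. -/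

import Mathlib

open MeasureTheory

universe u v w x

noncomputable section

namespace HSA

/-! ### Shannon entropy of finitely-valued random variables, in base `b` units -/

section Entropy

variable {Ω : Type u} [MeasurableSpace Ω] {A : Type v} {B : Type w} {C : Type x}
  [Fintype A] [Fintype B] [Fintype C]

/-- The entropy `H(X) = -∑ₐ P(X = a) log_b P(X = a)`. -/
def entropy (b : ℝ) (μ : Measure Ω) (X : Ω → A) : ℝ :=
  ∑ a : A, Real.negMulLog (μ.real (X ⁻¹' {a})) / Real.log b

/-- The conditional entropy `H(X | Y) = H(X, Y) - H(Y)`. -/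
def condEntropy (b : ℝ) (μ : Measure Ω) (X : Ω → A) (Y : Ω → B) : ℝ :=
  entropy b μ (fun ω => (X ω, Y ω)) - entropy b μ Y

/-- The conditional mutual information `I(X; Y | Z) = H(X | Z) - H(X | Y, Z)`. -/
def condMutualInfo (b : ℝ) (μ : Measure Ω) (X : Ω → A) (Y : Ω → B) (Z : Ω → C) : ℝ :=
  condEntropy b μ X Z - condEntropy b μ X (fun ω => (Y ω, Z ω))

end Entropy

/-! ### Three-layer networks -/

/-- The users connected to relay `j`, when user `i` is connected to the relays in `net i`. -/
def usersOf {N K : ℕ} (net : Fin N → Finset (Fin K)) (j : Fin K) : Finset (Fin N) :=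
  Finset.univ.filter fun i => j ∈ net i

/-- The cyclic network with `N` users and `N` relays: user `i` is connected to the `n` relays
`i, i - 1, …, i - n + 1` modulo `N`, i.e. relay `j` serves the users `j, j + 1, …, j + n - 1`
modulo `N`. -/
def cyclicNetwork (N n : ℕ) (i : Fin N) : Finset (Fin N) :=
  Finset.univ.filter fun j => ∃ p ∈ Finset.range n, ((j : ℕ) + p) % N = (i : ℕ)

/-! ### Hierarchical secure aggregation schemes -/

/-- A hierarchical aggregation scheme over the finite field `F` for the network `net`
(decodability and security are imposed separately). All random variables are defined on one
probability space. The messages on the links may use arbitrary finite alphabets; `X i j` is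
meaningful only when relay `j` is connected to user `i`. -/
structure Scheme (F : Type u) [Field F] [Fintype F] {N K : ℕ}
    (net : Fin N → Finset (Fin K)) where
  /-- the sample space -/
  Ω : Type u
  [mΩ : MeasurableSpace Ω]
  /-- the probability measure -/
  μ : Measure Ω
  [prob : IsProbabilityMeasure μ]
  /-- number of symbols of each input -/
  L : ℕ
  L_pos : 0 < L
  /-- number of symbols of each individual key -/
  LZ : ℕ
  /-- number of symbols of the stored source key -/
  srcLen : ℕ
  /-- alphabet of the user-to-relay messages -/
  MsgX : Type u
  [fintypeMsgX : Fintype MsgX]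
  /-- alphabet of the relay-to-server messages -/
  MsgY : Type u
  [fintypeMsgY : Fintype MsgY]
  /-- the inputs -/
  W : Fin N → Ω → (Fin L → F)
  /-- the individual keys -/
  Z : Fin N → Ω → (Fin LZ → F)
  /-- the source key -/
  src : Ω → (Fin srcLen → F)
  /-- the user-to-relay messages -/
  X : Fin N → Fin K → Ω → MsgX
  /-- the relay-to-server messages -/
  Y : Fin K → Ω → MsgY
  measurable_W : ∀ i, @Measurable Ω (Fin L → F) mΩ ⊤ (W i)
  measurable_Z : ∀ i, @Measurable Ω (Fin LZ → F) mΩ ⊤ (Z i)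
  measurable_src : @Measurable Ω (Fin srcLen → F) mΩ ⊤ src
  measurable_X : ∀ i j, @Measurable Ω MsgX mΩ ⊤ (X i j)
  measurable_Y : ∀ j, @Measurable Ω MsgY mΩ ⊤ (Y j)
  /-- The inputs are independent and uniformly distributed on `F ^ L`: their joint law is uniform. -/
  uniform_W : ∀ w : Fin N → Fin L → F,
    μ.real {ω | ∀ i, W i ω = w i} = 1 / (Fintype.card F : ℝ) ^ (N * L)
  /-- The family of keys is independent of the family of inputs. -/
  indep_W_Z : ∀ (w : Fin N → Fin L → F) (z : Fin N → Fin LZ → F),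
    μ.real {ω | (∀ i, W i ω = w i) ∧ (∀ i, Z i ω = z i)} =
      μ.real {ω | ∀ i, W i ω = w i} * μ.real {ω | ∀ i, Z i ω = z i}
  /-- The keys are derived from the source key: `H(Z_1, …, Z_N | Z_Σ) = 0`. -/
  keys_from_src : condEntropy (Fintype.card F) μ (fun ω i => Z i ω) src = 0
  /-- First hop: `H({X_{i,j}}_{j ∈ H_i} | W_i, Z_i) = 0`. -/
  first_hop : ∀ i, condEntropy (Fintype.card F) μ
    (fun ω (j : net i) => X i j ω) (fun ω => (W i ω, Z i ω)) = 0
  /-- Second hop: `H(Y_j | {X_{i,j}}_{i ∈ U_j}) = 0`. -/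
  second_hop : ∀ j, condEntropy (Fintype.card F) μ
    (Y j) (fun ω (i : usersOf net j) => X i j ω) = 0

attribute [instance] Scheme.mΩ Scheme.prob Scheme.fintypeMsgX Scheme.fintypeMsgY

namespace Scheme

variable {F : Type u} [Field F] [Fintype F] {N K : ℕ} {net : Fin N → Finset (Fin K)}

/-- Entropy in `q`-ary units, `q = |F|`, of a random variable of the scheme. -/
def H (S : Scheme F net) {A : Type v} [Fintype A] (V : S.Ω → A) : ℝ :=
  entropy (Fintype.card F) S.μ V

/-- Decodability: `H(∑ᵢ W_i | Y_1, …, Y_K) = 0`. -/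
def Decodable (S : Scheme F net) : Prop :=
  condEntropy (Fintype.card F) S.μ (fun ω => ∑ i, S.W i ω) (fun ω j => S.Y j ω) = 0

/-- The scheme is a `(0, Th, Tu)`-secure aggregation scheme: it is decodable, and any at most
`Th` relays colluding with any at most `Tu` users learn nothing about the inputs:
`I(W_[N]; {X_{i,j} : i ∈ U_j}_{j ∈ 𝒯h} | {W_i, Z_i}_{i ∈ 𝒯u}) = 0`. -/
def IsSecure (S : Scheme F net) (Th Tu : ℕ) : Prop :=
  S.Decodable ∧
    ∀ (R : Finset (Fin K)) (U : Finset (Fin N)), R.card ≤ Th → U.card ≤ Tu →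
      condMutualInfo (Fintype.card F) S.μ
        (fun ω i => S.W i ω)
        (fun ω (j : R) (i : usersOf net j) => S.X i j ω)
        (fun ω (i : U) => (S.W i ω, S.Z i ω)) = 0

/-- `R_X`, the maximum of `H(X_{i,j}) / L` over all user-relay links. -/
def RX (S : Scheme F net) : ℝ :=
  ⨆ e : {e : Fin N × Fin K // e.2 ∈ net e.1}, S.H (S.X e.1.1 e.1.2) / S.L

/-- `R_Y`, the maximum of `H(Y_j) / L` over all relays. -/
def RY (S : Scheme F net) : ℝ :=
  ⨆ j : Fin K, S.H (S.Y j) / S.L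

/-- `R_Z = L_Z / L`. -/
def RZ (S : Scheme F net) : ℝ := S.LZ / S.L

/-- `L_{Z_Σ} = H(Z_1, …, Z_N)`. -/
def LZSigma (S : Scheme F net) : ℝ := S.H (fun ω i => S.Z i ω)

/-- `R_{Z_Σ} = L_{Z_Σ} / L`. -/
def RZSigma (S : Scheme F net) : ℝ := S.LZSigma / S.L

/-- The source key consists of exactly `L_{Z_Σ} = H(Z_1, …, Z_N)` symbols. -/
def SourceKeyExact (S : Scheme F net) : Prop := (S.srcLen : ℝ) = S.LZSigma

end Scheme

/-- `S` is a `(0, 1, T)`-secure scheme over the cyclic network with `n = m = 2` that has the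
communication loads `R_X = R_Y = 1 / 2`. -/
def IsCommOptimalSecure {F : Type u} [Field F] [Fintype F] {N : ℕ} (T : ℕ)
    (S : Scheme F (cyclicNetwork N 2)) : Prop :=
  S.IsSecure 1 T ∧ S.RX = 1 / 2 ∧ S.RY = 1 / 2

/-- `(rZ, rSigma)` are the optimal key rates among the `(0, 1, T)`-secure schemes with
communication loads `1 / 2`: both are lower bounds for all such schemes (whether or not the source
key is longer than `H(Z_1, …, Z_N)`), and one scheme, whose source key consists of exactly
`H(Z_1, …, Z_N)` symbols, attains both. -/
def OptimalKeyRates (F : Type u) [Field F] [Fintype F] (N T : ℕ) (rZ rSigma : ℝ) : Prop :=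
  (∀ S : Scheme F (cyclicNetwork N 2), IsCommOptimalSecure T S →
      rZ ≤ S.RZ ∧ rSigma ≤ S.RZSigma) ∧
    ∃ S : Scheme F (cyclicNetwork N 2), IsCommOptimalSecure T S ∧ S.SourceKeyExact ∧
      S.RZ = rZ ∧ S.RZSigma = rSigma

end HSA

end

/-!
The theorem combines entropy inequalities for arbitrary schemes with two linear schemes.

**Lower bounds.** In the cyclic network user `i` is served by the relays `i` and `i - 1`. Given the
inputs and keys of all other users, the messages of these two relays, and a fortiori the two
messages of user `i`, determine `W_i`, which is still uniform. So two messages carry at least `L`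
symbols, and both loads are at least `1 / 2`. If the user load is exactly `1 / 2`, each message has
conditional entropy exactly `L / 2` given everything known to the other users
(`Scheme.message_gap`), and the two messages of user `i` are determined by `W_i` and the inputs and
keys of the others (`Scheme.H_sent_W_view_le`). Security at a relay says that the conditional
entropy of its messages given a colluding set `U` remains when all inputs are revealed, and so is
provided by keys (`Scheme.IsSecure.key_gap`). Hence, given the keys of `U`, one more key has entropy
at least `L / 2`, two more keys at a common relay have at least `L`, and a single key has at
least `L` if all users except `i` and `i + 1` may collude. The chain rule gives the bounds on
`H(Z_1, …, Z_N)`. If all users except one may collude, security contradicts the fact that the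
messages of that user are determined by its input and the rest.

**Schemes.** Let `E` be a finite extension of `F` with at least `N` elements and `x_1, …, x_N`
distinct elements of `E`. Inputs are vectors of `E × E`; user `i` adds a mask to its input and sends
to its two relays `j` the coordinates with respect to the basis of the vectors `(1, x_j)`; relays
add, and the masks sum to zero, so that the relay messages are coefficients of the sum of the
inputs. The scheme is secure as soon as the keys of the colluding users and the masks of the other
messages to a relay can be prescribed independently (`Scheme.KeysGeneric`). For `T ≤ N - 3` the
masks are `(0, z_i)`, where `(z_1, …, z_N)` runs through a generalized Reed–Solomon code of dimension
`T + 2` all of whose words have sum zero. For `T = N - 2` the masks are arbitrary vectors with sum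
zero.
-/

namespace HSA

/-! ### Finite sums of `t ↦ -t log t` -/

section NegMulLog

open Real Finset

/-- Grouping the atoms of a nonnegative weight does not increase its entropy. -/
lemma negMulLog_sum_le {ι : Type*} (s : Finset ι) (p : ι → ℝ) (hp : ∀ i ∈ s, 0 ≤ p i) :
    negMulLog (∑ i ∈ s, p i) ≤ ∑ i ∈ s, negMulLog (p i) := by
  have h : negMulLog (∑ i ∈ s, p i) = ∑ i ∈ s, -p i * log (∑ i ∈ s, p i) := by
    rw [negMulLog, ← Finset.sum_mul, Finset.sum_neg_distrib]
  rw [h]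
  refine Finset.sum_le_sum fun i hi => ?_
  rcases (hp i hi).eq_or_lt with h0 | h0
  · simp [← h0]
  · have h1 : p i ≤ ∑ i ∈ s, p i := Finset.single_le_sum hp hi
    have h2 := Real.log_le_log h0 h1
    rw [negMulLog]
    nlinarith

/-- A weight of total mass one on a finite set has at most the entropy of the uniform weight. -/
lemma sum_negMulLog_le_log_card {ι : Type*} [Fintype ι] (p : ι → ℝ) (hp : ∀ i, 0 ≤ p i)
    (h1 : ∑ i, p i = 1) : ∑ i, negMulLog (p i) ≤ log (Fintype.card ι) := by
  have hn : 0 < (Fintype.card ι : ℝ) := by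
    rcases isEmpty_or_nonempty ι with h | h
    · simp at h1
    · exact_mod_cast Fintype.card_pos
  have h : ∀ i, negMulLog (p i) ≤ p i * log (Fintype.card ι) + ((Fintype.card ι : ℝ)⁻¹ - p i) := by
    intro i
    rcases (hp i).eq_or_lt with h0 | h0
    · simp [← h0]
    · have := Real.log_le_sub_one_of_pos (x := (p i * Fintype.card ι)⁻¹) (by positivity)
      rw [Real.log_inv, Real.log_mul h0.ne' hn.ne'] at this
      rw [negMulLog]
      have h3 : p i * (p i * Fintype.card ι)⁻¹ = (Fintype.card ι : ℝ)⁻¹ := by field_simp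
      nlinarith
  calc _ ≤ ∑ i, (p i * log (Fintype.card ι) + ((Fintype.card ι : ℝ)⁻¹ - p i)) :=
        Finset.sum_le_sum fun i _ => h i
    _ = _ := by
      rw [Finset.sum_add_distrib, ← Finset.sum_mul, Finset.sum_sub_distrib, h1]
      simp [hn.ne']

/-- Subadditivity of entropy for an unnormalized weight on a product. -/
lemma sum_negMulLog_prod_add_le {ι κ : Type*} [Fintype ι] [Fintype κ] (p : ι → κ → ℝ)
    (hp : ∀ i k, 0 ≤ p i k) :
    ∑ i, ∑ k, negMulLog (p i k) + negMulLog (∑ i, ∑ k, p i k) ≤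
      ∑ i, negMulLog (∑ k, p i k) + ∑ k, negMulLog (∑ i, p i k) := by
  set t := ∑ i, ∑ k, p i k with ht
  set a : ι → ℝ := fun i => ∑ k, p i k with ha
  set b : κ → ℝ := fun k => ∑ i, p i k with hb
  have hat : ∑ i, a i = t := rfl
  have hbt : ∑ k, b k = t := by rw [ht, Finset.sum_comm]
  have ha0 : ∀ i, 0 ≤ a i := fun i => Finset.sum_nonneg fun k _ => hp i k
  have hb0 : ∀ k, 0 ≤ b k := fun k => Finset.sum_nonneg fun i _ => hp i k
  have ht0 : 0 ≤ t := Finset.sum_nonneg fun i _ => ha0 i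
  have key : ∀ i k, p i k * log (a i) + p i k * log (b k) ≤
      p i k * log (p i k) + p i k * log t - (p i k - a i * b k / t) := by
    intro i k
    rcases (hp i k).eq_or_lt with h0 | h0
    · rw [← h0]
      have : 0 ≤ a i * b k / t := div_nonneg (mul_nonneg (ha0 i) (hb0 k)) ht0
      simpa using this
    · have h1 : 0 < a i :=
        h0.trans_le (Finset.single_le_sum (f := fun k => p i k) (fun k _ => hp i k) (mem_univ k))
      have h2 : 0 < b k :=
        h0.trans_le (Finset.single_le_sum (f := fun i => p i k) (fun i _ => hp i k) (mem_univ i))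
      have h3 : 0 < t := h1.trans_le (Finset.single_le_sum (fun i _ => ha0 i) (mem_univ i))
      have := Real.log_le_sub_one_of_pos (x := a i * b k / (p i k * t)) (by positivity)
      rw [Real.log_div (by positivity) (by positivity), Real.log_mul h1.ne' h2.ne',
        Real.log_mul h0.ne' h3.ne'] at this
      have h4 : p i k * (a i * b k / (p i k * t)) = a i * b k / t := by field_simp
      nlinarith
  have hsum := Finset.sum_le_sum fun i (_ : i ∈ univ) =>
    Finset.sum_le_sum fun k (_ : k ∈ univ) => key i k
  simp only [Finset.sum_add_distrib, Finset.sum_sub_distrib] at hsum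
  have e1 : ∑ i, ∑ k, p i k * log (a i) = -∑ i, negMulLog (a i) := by
    rw [← Finset.sum_neg_distrib]
    refine Finset.sum_congr rfl fun i _ => ?_
    rw [← Finset.sum_mul, negMulLog]; ring
  have e2 : ∑ i, ∑ k, p i k * log (b k) = -∑ k, negMulLog (b k) := by
    rw [Finset.sum_comm, ← Finset.sum_neg_distrib]
    refine Finset.sum_congr rfl fun i _ => ?_
    rw [← Finset.sum_mul, negMulLog]; ring
  have e3 : ∑ i, ∑ k, p i k * log (p i k) = -∑ i, ∑ k, negMulLog (p i k) := by
    simp [negMulLog]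
  have e4 : ∑ i, ∑ k, p i k * log t = -negMulLog t := by
    simp_rw [← Finset.sum_mul]
    rw [negMulLog]; ring
  have e5 : ∑ i, ∑ k, a i * b k / t = t := by
    simp_rw [mul_div_assoc, ← Finset.mul_sum, ← Finset.sum_div, ← Finset.sum_mul, hat, hbt]
    rcases ht0.eq_or_lt with h | h
    · simp [← h]
    · field_simp
  rw [e1, e2, e3, e4, e5, ← ht] at hsum
  linarith

end NegMulLog

/-! ### Calculus of entropies of finitely-valued random variables -/

section Entropy

variable {Ω : Type*} [MeasurableSpace Ω] {A B C : Type*}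

/-- `X` is a random variable when its values are regarded as a discrete space. -/
def IsRV (X : Ω → A) : Prop := ∀ s : Set A, MeasurableSet (X ⁻¹' s)

lemma IsRV.comp {X : Ω → A} (hX : IsRV X) (g : A → B) : IsRV fun ω => g (X ω) :=
  fun s => hX (g ⁻¹' s)

lemma IsRV.of_singleton [Finite A] {X : Ω → A} (h : ∀ a, MeasurableSet (X ⁻¹' {a})) :
    IsRV X := by
  intro s
  rw [← Set.biUnion_preimage_singleton]
  exact s.toFinite.measurableSet_biUnion fun a _ => h a

lemma IsRV.prodMk [Finite A] [Finite B] {X : Ω → A} {Y : Ω → B} (hX : IsRV X) (hY : IsRV Y) :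
    IsRV fun ω => (X ω, Y ω) := by
  refine .of_singleton fun a => ?_
  convert (hX {a.1}).inter (hY {a.2}) using 1
  ext ω; simp [Prod.ext_iff]

lemma IsRV.pi {ι : Type*} [Finite ι] {A : ι → Type*} [∀ i, Finite (A i)]
    {X : ∀ i, Ω → A i} (hX : ∀ i, IsRV (X i)) : IsRV fun ω i => X i ω := by
  refine .of_singleton fun a => ?_
  convert MeasurableSet.iInter fun i => hX i {a i} using 1
  ext ω; simp [funext_iff]

variable [Fintype A] {b : ℝ} {μ : Measure Ω} [IsProbabilityMeasure μ] {X : Ω → A}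

open Finset in
/-- The law of a function of `X` in terms of the law of `X`. -/
lemma IsRV.measureReal_comp (hX : IsRV X) (g : A → B) [DecidableEq B] (c : B) :
    μ.real ((fun ω => g (X ω)) ⁻¹' {c}) = ∑ a with g a = c, μ.real (X ⁻¹' {a}) := by
  rw [sum_measureReal_preimage_singleton _ (fun a _ => hX {a})]
  congr 1
  ext ω; simp

lemma IsRV.sum_measureReal (hX : IsRV X) : ∑ a, μ.real (X ⁻¹' {a}) = 1 := by
  rw [sum_measureReal_preimage_singleton _ (fun a _ => hX {a})]
  simp

variable [Fintype B] [Fintype C] {Y : Ω → B} {Z : Ω → C}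

lemma IsRV.measureReal_snd (hX : IsRV X) (hY : IsRV Y) (c : B) :
    μ.real (Y ⁻¹' {c}) = ∑ a, μ.real ((fun ω => (X ω, Y ω)) ⁻¹' {(a, c)}) := by
  classical
  rw [(hX.prodMk hY).measureReal_comp Prod.snd c]
  refine Finset.sum_nbij' Prod.fst (fun a => (a, c)) ?_ ?_ ?_ ?_ ?_ <;> aesop

lemma entropy_comp_le (hb : 1 < b) (hX : IsRV X) (g : A → B) :
    entropy b μ (fun ω => g (X ω)) ≤ entropy b μ X := by
  classical
  unfold entropy
  rw [← Finset.sum_div, ← Finset.sum_div]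
  refine div_le_div_of_nonneg_right ?_ (Real.log_pos hb).le
  simp_rw [hX.measureReal_comp g]
  refine (Finset.sum_le_sum fun c _ => negMulLog_sum_le _ _ fun a _ => measureReal_nonneg).trans ?_
  exact (Finset.sum_fiberwise Finset.univ g fun a => Real.negMulLog (μ.real (X ⁻¹' {a}))).le

/-- If, off a null set, the value of `X` determines the value of `Y`, then `H(Y) ≤ H(X)`. -/
lemma entropy_le_of_ae (hb : 1 < b) (hX : IsRV X) {G : Set Ω} (hG : ∀ᵐ ω ∂μ, ω ∈ G)
    (h : ∀ ω ∈ G, ∀ ω' ∈ G, X ω = X ω' → Y ω = Y ω') : entropy b μ Y ≤ entropy b μ X := by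
  classical
  obtain ⟨ω₀, -⟩ := hG.exists
  let g : A → B := fun a => if h : ∃ ω ∈ G, X ω = a then Y h.choose else Y ω₀
  have hg : ∀ ω ∈ G, g (X ω) = Y ω := by
    intro ω hω
    have hex : ∃ ω' ∈ G, X ω' = X ω := ⟨ω, hω, rfl⟩
    simp only [g, dif_pos hex]
    exact h _ hex.choose_spec.1 _ hω hex.choose_spec.2
  refine le_of_eq_of_le ?_ (entropy_comp_le hb hX g)
  unfold entropy
  refine Finset.sum_congr rfl fun c _ => ?_
  congr 2
  refine measureReal_congr ?_
  filter_upwards [hG] with ω hω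
  change (Y ω = c) = (g (X ω) = c)
  rw [hg ω hω]

lemma entropy_le_of_forall (hb : 1 < b) (hX : IsRV X) (h : ∀ ω ω', X ω = X ω' → Y ω = Y ω') :
    entropy b μ Y ≤ entropy b μ X :=
  entropy_le_of_ae hb hX (G := Set.univ) (by simp) fun ω _ ω' _ => h ω ω'

/-- The entropy of a random variable depends only on the partition that it induces. -/
lemma entropy_congr (hb : 1 < b) (hX : IsRV X) (hY : IsRV Y)
    (h : ∀ ω ω', X ω = X ω' ↔ Y ω = Y ω') : entropy b μ X = entropy b μ Y :=
  (entropy_le_of_forall hb hY fun ω ω' => (h ω ω').2).antisymm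
    (entropy_le_of_forall hb hX fun ω ω' => (h ω ω').1)

lemma entropy_le_log_card (hb : 1 < b) (hX : IsRV X) :
    entropy b μ X ≤ Real.log (Fintype.card A) / Real.log b := by
  unfold entropy
  rw [← Finset.sum_div]
  exact div_le_div_of_nonneg_right
    (sum_negMulLog_le_log_card _ (fun _ => measureReal_nonneg) hX.sum_measureReal)
    (Real.log_pos hb).le

/-- Submodularity of entropy, that is, nonnegativity of the conditional mutual information. -/
lemma entropy_submodular (hb : 1 < b) (hX : IsRV X) (hY : IsRV Y) (hZ : IsRV Z) :
    entropy b μ (fun ω => (X ω, Y ω, Z ω)) + entropy b μ Z ≤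
      entropy b μ (fun ω => (X ω, Z ω)) + entropy b μ (fun ω => (Y ω, Z ω)) := by
  have hXZ : ∀ x z, μ.real ((fun ω => (X ω, Z ω)) ⁻¹' {(x, z)}) =
      ∑ y, μ.real ((fun ω => (X ω, Y ω, Z ω)) ⁻¹' {(x, y, z)}) := by
    intro x z
    rw [hY.measureReal_snd (hX.prodMk hZ) (x, z)]
    refine Finset.sum_congr rfl fun y _ => congrArg _ ?_
    ext ω; simp; tauto
  have hYZ : ∀ y z, μ.real ((fun ω => (Y ω, Z ω)) ⁻¹' {(y, z)}) =
      ∑ x, μ.real ((fun ω => (X ω, Y ω, Z ω)) ⁻¹' {(x, y, z)}) :=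
    fun y z => hX.measureReal_snd (hY.prodMk hZ) (y, z)
  have h := Finset.sum_le_sum fun z (_ : z ∈ Finset.univ) => sum_negMulLog_prod_add_le
    (fun x y => μ.real ((fun ω => (X ω, Y ω, Z ω)) ⁻¹' {(x, y, z)})) fun _ _ => measureReal_nonneg
  simp only [← hXZ, ← hYZ, ← hX.measureReal_snd hZ, Finset.sum_add_distrib] at h
  have e1 : ∑ z, ∑ x, ∑ y,
      Real.negMulLog (μ.real ((fun ω => (X ω, Y ω, Z ω)) ⁻¹' {(x, y, z)})) =
      ∑ x, ∑ y, ∑ z, Real.negMulLog (μ.real ((fun ω => (X ω, Y ω, Z ω)) ⁻¹' {(x, y, z)})) := by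
    rw [Finset.sum_comm]
    exact Finset.sum_congr rfl fun x _ => Finset.sum_comm
  rw [e1, Finset.sum_comm (f := fun z x => Real.negMulLog (μ.real ((fun ω => (X ω, Z ω)) ⁻¹' _))),
    Finset.sum_comm (f := fun z y => Real.negMulLog (μ.real ((fun ω => (Y ω, Z ω)) ⁻¹' _)))] at h
  unfold entropy
  simp_rw [← Finset.sum_div, ← add_div, Fintype.sum_prod_type]
  exact div_le_div_of_nonneg_right h (Real.log_pos hb).le

lemma entropy_prodMk_le (hb : 1 < b) (hX : IsRV X) (hY : IsRV Y) :
    entropy b μ (fun ω => (X ω, Y ω)) ≤ entropy b μ X + entropy b μ Y := by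
  have hU : IsRV fun _ : Ω => () := fun s => MeasurableSet.const (() ∈ s)
  have h := entropy_submodular (μ := μ) hb hX hY hU
  have h1 : entropy b μ (fun _ : Ω => ()) = 0 := by simp [entropy]
  rw [entropy_congr hb (hX.prodMk (hY.prodMk hU)) (hX.prodMk hY) (by simp),
    entropy_congr hb (hX.prodMk hU) hX (by simp), entropy_congr hb (hY.prodMk hU) hY (by simp),
    h1] at h
  linarith

/-- Conditioning on more reduces entropy: `H(X | Y) ≤ H(X | Z)` if `Y` determines `Z` off a null
set. -/
lemma condEntropy_anti (hb : 1 < b) (hX : IsRV X) (hY : IsRV Y) (hZ : IsRV Z) {G : Set Ω}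
    (hG : ∀ᵐ ω ∂μ, ω ∈ G) (h : ∀ ω ∈ G, ∀ ω' ∈ G, Y ω = Y ω' → Z ω = Z ω') :
    entropy b μ (fun ω => (X ω, Y ω)) - entropy b μ Y ≤
      entropy b μ (fun ω => (X ω, Z ω)) - entropy b μ Z := by
  have h1 := entropy_submodular (μ := μ) hb hX hY hZ
  have h2 : entropy b μ (fun ω => (X ω, Y ω)) ≤ entropy b μ (fun ω => (X ω, Y ω, Z ω)) :=
    entropy_le_of_forall hb (hX.prodMk (hY.prodMk hZ)) (by simp +contextual)
  have h3 : entropy b μ (fun ω => (Y ω, Z ω)) ≤ entropy b μ Y :=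
    entropy_le_of_ae hb hY hG fun ω hω ω' hω' e => Prod.ext e (h ω hω ω' hω' e)
  linarith

lemma condEntropy_eq_zero_of_forall (hb : 1 < b) (hX : IsRV X) (hY : IsRV Y)
    (h : ∀ ω ω', Y ω = Y ω' → X ω = X ω') : condEntropy b μ X Y = 0 := by
  unfold condEntropy
  rw [entropy_congr hb (hX.prodMk hY) hY fun ω ω' => ?_, sub_self]
  simpa using h ω ω'

/-- `H(X | Y) = 0` means that off a null set `Y` determines `X`. -/
lemma exists_ae_of_condEntropy_eq_zero (hb : 1 < b) (hX : IsRV X) (hY : IsRV Y)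
    (h : condEntropy b μ X Y = 0) :
    ∃ G : Set Ω, (∀ᵐ ω ∂μ, ω ∈ G) ∧ ∀ ω ∈ G, ∀ ω' ∈ G, Y ω = Y ω' → X ω = X ω' := by
  set p : A → B → ℝ := fun x y => μ.real ((fun ω => (X ω, Y ω)) ⁻¹' {(x, y)}) with hp
  have hp0 : ∀ x y, 0 ≤ p x y := fun _ _ => measureReal_nonneg
  have hle : ∀ x y, p x y ≤ ∑ x, p x y := fun x y =>
    Finset.single_le_sum (f := fun x => p x y) (fun x _ => hp0 x y) (Finset.mem_univ x)
  have hterm : ∀ y x, 0 ≤ p x y * (Real.log (∑ x, p x y) - Real.log (p x y)) := by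
    intro y x
    rcases (hp0 x y).eq_or_lt with h0 | h0
    · simp [← h0]
    · exact mul_nonneg h0.le (sub_nonneg.2 (Real.log_le_log h0 (hle x y)))
  have hsum : ∑ y, ∑ x, p x y * (Real.log (∑ x, p x y) - Real.log (p x y)) = 0 := by
    unfold condEntropy entropy at h
    simp_rw [← Finset.sum_div, ← sub_div, Fintype.sum_prod_type, hX.measureReal_snd hY] at h
    rw [div_eq_zero_iff, or_iff_left (Real.log_pos hb).ne', Finset.sum_comm,
      ← Finset.sum_sub_distrib] at h
    rw [← h]
    refine Finset.sum_congr rfl fun y _ => ?_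
    simp_rw [mul_sub, Finset.sum_sub_distrib, ← Finset.sum_mul, Real.negMulLog, neg_mul,
      Finset.sum_neg_distrib]
    ring
  have hzero : ∀ x y, 0 < p x y → p x y = ∑ x, p x y := by
    intro x y hxy
    have h1 := (Finset.sum_eq_zero_iff_of_nonneg
      fun y _ => Finset.sum_nonneg fun x _ => hterm y x).1 hsum y (Finset.mem_univ y)
    have h2 := (Finset.sum_eq_zero_iff_of_nonneg fun x _ => hterm y x).1 h1 x (Finset.mem_univ x)
    rcases mul_eq_zero.1 h2 with h3 | h3
    · exact absurd h3 hxy.ne'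
    · exact (Real.log_injOn_pos (hxy.trans_le (hle x y)) hxy (sub_eq_zero.1 h3)).symm
  refine ⟨{ω | 0 < p (X ω) (Y ω)}, ?_, ?_⟩
  · have : ∀ a : A × B, ∀ᵐ ω ∂μ, (X ω, Y ω) = a → 0 < p (X ω) (Y ω) := by
      intro a
      rcases (hp0 a.1 a.2).eq_or_lt with h0 | h0
      · have h1 : μ ((fun ω => (X ω, Y ω)) ⁻¹' {a}) = 0 := by
          have : μ.real ((fun ω => (X ω, Y ω)) ⁻¹' {a}) = 0 := h0.symm
          rwa [measureReal_eq_zero_iff] at this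
        have h2 : ∀ᵐ ω ∂μ, ω ∉ (fun ω => (X ω, Y ω)) ⁻¹' {a} := measure_eq_zero_iff_ae_notMem.1 h1
        filter_upwards [h2] with ω hω e
        exact absurd e hω
      · refine Filter.Eventually.of_forall fun ω e => ?_
        rw [← e] at h0
        exact h0
    filter_upwards [ae_all_iff.2 this] with ω hω
    exact hω _ rfl
  · intro ω hω ω' hω' e
    by_contra hne
    simp only [Set.mem_ofPred_eq, ← e] at hω hω'
    have h1 := hzero _ _ hω
    have h2 := hzero _ _ hω'
    have h3 : p (X ω) (Y ω) + p (X ω') (Y ω) ≤ ∑ x, p x (Y ω) := by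
      classical
      rw [← Finset.sum_pair hne (f := fun x => p x (Y ω))]
      exact Finset.sum_le_univ_sum_of_nonneg fun x => hp0 x _
    linarith

end Entropy

/-! ### Uniform and independent random variables -/

section Entropy

variable {Ω : Type*} [MeasurableSpace Ω] {A B : Type*} [Fintype A] [Fintype B] {b : ℝ}
  {μ : Measure Ω} {X : Ω → A} {Y : Ω → B}

lemma entropy_of_uniform (h : ∀ a, μ.real (X ⁻¹' {a}) = 1 / Fintype.card A) :
    entropy b μ X = Real.log (Fintype.card A) / Real.log b := by
  unfold entropy
  simp only [h, Finset.sum_const, Finset.card_univ, nsmul_eq_mul, Real.negMulLog, one_div,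
    Real.log_inv]
  rcases eq_or_ne (Fintype.card A : ℝ) 0 with h0 | h0
  · simp [h0]
  · field_simp

lemma entropy_prodMk_of_indep [IsProbabilityMeasure μ] (hX : IsRV X) (hY : IsRV Y)
    (h : ∀ a c, μ.real ((fun ω => (X ω, Y ω)) ⁻¹' {(a, c)}) =
      μ.real (X ⁻¹' {a}) * μ.real (Y ⁻¹' {c})) :
    entropy b μ (fun ω => (X ω, Y ω)) = entropy b μ X + entropy b μ Y := by
  unfold entropy
  simp_rw [← Finset.sum_div, ← add_div, Fintype.sum_prod_type, h, Real.negMulLog_mul,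
    Finset.sum_add_distrib, ← Finset.mul_sum, ← Finset.sum_mul, hX.sum_measureReal,
    hY.sum_measureReal, one_mul]

lemma log_card_div_log (F : Type*) [Fintype F] (hF : 1 < (Fintype.card F : ℝ)) {n : ℕ}
    (hA : Fintype.card A = Fintype.card F ^ n) :
    Real.log (Fintype.card A) / Real.log (Fintype.card F) = n := by
  rw [hA, Nat.cast_pow, Real.log_pow, mul_div_cancel_right₀ _ (Real.log_pos hF).ne']

end Entropy

/-! ### Entropies in an aggregation scheme over an arbitrary network -/

namespace Scheme

variable {F : Type u} [Field F] [Fintype F] {N K : ℕ} {net : Fin N → Finset (Fin K)}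

lemma one_lt_card (F : Type u) [Field F] [Fintype F] : 1 < (Fintype.card F : ℝ) := by
  exact_mod_cast Fintype.one_lt_card

variable (S : Scheme F net)

/-- All inputs together. -/
def inputs (ω : S.Ω) : Fin N → Fin S.L → F := fun i => S.W i ω

/-- The keys of the users in `U`. -/
def keysOn (U : Finset (Fin N)) (ω : S.Ω) : U → Fin S.LZ → F := fun i => S.Z i ω

/-- The inputs and keys of the users in `U`. -/
def view (U : Finset (Fin N)) (ω : S.Ω) : U → (Fin S.L → F) × (Fin S.LZ → F) :=
  fun i => (S.W i ω, S.Z i ω)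

/-- The messages that user `i` sends. -/
def sent (i : Fin N) (ω : S.Ω) : net i → S.MsgX := fun j => S.X i j ω

/-- The messages that relay `j` receives. -/
def received (j : Fin K) (ω : S.Ω) : usersOf net j → S.MsgX := fun i => S.X i j ω

variable {S}

lemma isRV_W (i : Fin N) : IsRV (S.W i) := fun _ => S.measurable_W i trivial
lemma isRV_Z (i : Fin N) : IsRV (S.Z i) := fun _ => S.measurable_Z i trivial
lemma isRV_X (i : Fin N) (j : Fin K) : IsRV (S.X i j) := fun _ => S.measurable_X i j trivial
lemma isRV_Y (j : Fin K) : IsRV (S.Y j) := fun _ => S.measurable_Y j trivial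
lemma isRV_inputs : IsRV S.inputs := .pi isRV_W
lemma isRV_keysOn (U : Finset (Fin N)) : IsRV (S.keysOn U) := .pi fun i => isRV_Z i.1
lemma isRV_view (U : Finset (Fin N)) : IsRV (S.view U) :=
  .pi fun i => (isRV_W i.1).prodMk (isRV_Z i.1)
lemma isRV_sent (i : Fin N) : IsRV (S.sent i) := .pi fun j => isRV_X i j.1
lemma isRV_received (j : Fin K) : IsRV (S.received j) := .pi fun i => isRV_X i.1 j

lemma view_eq_iff {U : Finset (Fin N)} {ω ω' : S.Ω} :
    S.view U ω = S.view U ω' ↔ ∀ i ∈ U, S.W i ω = S.W i ω' ∧ S.Z i ω = S.Z i ω' := by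
  simp [view, funext_iff (α := U)]

lemma keysOn_eq_iff {U : Finset (Fin N)} {ω ω' : S.Ω} :
    S.keysOn U ω = S.keysOn U ω' ↔ ∀ i ∈ U, S.Z i ω = S.Z i ω' := by
  simp [keysOn, funext_iff (α := U)]

lemma inputs_eq_iff {ω ω' : S.Ω} : S.inputs ω = S.inputs ω' ↔ ∀ i, S.W i ω = S.W i ω' := by
  simp [inputs, funext_iff (α := Fin N)]

lemma sent_eq_iff {i : Fin N} {ω ω' : S.Ω} :
    S.sent i ω = S.sent i ω' ↔ ∀ j ∈ net i, S.X i j ω = S.X i j ω' := by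
  simp [sent, funext_iff]

lemma received_eq_iff {j : Fin K} {ω ω' : S.Ω} :
    S.received j ω = S.received j ω' ↔ ∀ i, j ∈ net i → S.X i j ω = S.X i j ω' := by
  have hmem : ∀ i, i ∈ usersOf net j ↔ j ∈ net i := fun i => by simp [usersOf]
  exact ⟨fun h i hi => congrFun h ⟨i, (hmem i).2 hi⟩, fun h => funext fun i => h i ((hmem i).1 i.2)⟩

lemma H_inputs : S.H S.inputs = N * S.L := by
  have hc : Fintype.card (Fin N → Fin S.L → F) = Fintype.card F ^ (N * S.L) := by
    simp [← pow_mul, mul_comm]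
  rw [H, entropy_of_uniform, log_card_div_log F (one_lt_card F) hc, Nat.cast_mul]
  intro w
  rw [hc, Nat.cast_pow, ← S.uniform_W w]
  congr 1
  ext ω; simp [inputs, funext_iff (α := Fin N)]

/-- The inputs are independent of any function of the keys. -/
lemma H_inputs_keysOn (U : Finset (Fin N)) :
    S.H (fun ω => (S.inputs ω, S.keysOn U ω)) = N * S.L + S.H (S.keysOn U) := by
  have hb := one_lt_card F
  have hZ : IsRV fun ω i => S.Z i ω := .pi isRV_Z
  have h1 : S.H (fun ω => (S.inputs ω, fun i => S.Z i ω)) =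
      S.H S.inputs + S.H fun ω i => S.Z i ω := by
    refine entropy_prodMk_of_indep isRV_inputs hZ fun w z => ?_
    have e := S.indep_W_Z w z
    convert e using 2
    · ext ω; simp [inputs, funext_iff (α := Fin N)]
    · congr 1; ext ω; simp [inputs, funext_iff (α := Fin N)]
    · congr 1; ext ω; simp [funext_iff (α := Fin N)]
  have h2 : S.H (fun ω => (S.inputs ω, fun i => S.Z i ω)) - S.H (fun ω i => S.Z i ω) ≤
      S.H (fun ω => (S.inputs ω, S.keysOn U ω)) - S.H (S.keysOn U) :=
    condEntropy_anti hb isRV_inputs hZ (isRV_keysOn U) (G := Set.univ) (by simp)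
      fun ω _ ω' _ e => keysOn_eq_iff.2 fun i _ => congrFun e i
  have h3 : S.H (fun ω => (S.inputs ω, S.keysOn U ω)) ≤ S.H S.inputs + S.H (S.keysOn U) :=
    entropy_prodMk_le hb isRV_inputs (isRV_keysOn U)
  rw [H_inputs] at h1 h3
  linarith

lemma H_inputs_view (U : Finset (Fin N)) :
    S.H (fun ω => (S.inputs ω, S.view U ω)) = N * S.L + S.H (S.keysOn U) := by
  rw [← H_inputs_keysOn]
  refine entropy_congr (one_lt_card F) (isRV_inputs.prodMk (isRV_view U))
    (isRV_inputs.prodMk (isRV_keysOn U)) fun ω ω' => ?_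
  simp only [Prod.mk.injEq, view_eq_iff, inputs_eq_iff, keysOn_eq_iff]
  exact ⟨fun h => ⟨h.1, fun i hi => (h.2 i hi).2⟩, fun h => ⟨h.1, fun i hi => ⟨h.1 i, h.2 i hi⟩⟩⟩

/-- Given the inputs and keys of all other users, the input of a user is still uniform. -/
lemma L_add_H_view_le (i : Fin N) :
    S.L + S.H (S.view (Finset.univ.erase i)) ≤
      S.H (fun ω => (S.W i ω, S.view (Finset.univ.erase i) ω)) := by
  have hb := one_lt_card F
  set U := Finset.univ.erase i with hU
  have h1 : S.H (fun ω => (S.W i ω, S.view U ω)) = S.H (fun ω => (S.inputs ω, S.view U ω)) := by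
    refine entropy_congr hb ((isRV_W i).prodMk (isRV_view U)) (isRV_inputs.prodMk (isRV_view U))
      fun ω ω' => ?_
    simp only [Prod.mk.injEq, view_eq_iff, inputs_eq_iff]
    refine ⟨fun h => ⟨fun k => ?_, h.2⟩, fun h => ⟨h.1 i, h.2⟩⟩
    rcases eq_or_ne k i with rfl | hk
    · exact h.1
    · exact (h.2 k (by simp [hU, hk])).1
  have hR : IsRV (fun ω (k : U) => S.W k ω) := .pi fun k => isRV_W k.1
  have h2 : S.H (S.view U) ≤ S.H (fun ω => (fun (k : U) => S.W k ω, S.keysOn U ω)) :=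
    entropy_le_of_forall hb (hR.prodMk (isRV_keysOn U)) fun ω ω' h => by
      simp only [Prod.mk.injEq, keysOn_eq_iff] at h
      exact view_eq_iff.2 fun k hk => ⟨congrFun h.1 ⟨k, hk⟩, h.2 k hk⟩
  have h3 : S.H (fun ω => (fun (k : U) => S.W k ω, S.keysOn U ω)) ≤
      S.H (fun ω (k : U) => S.W k ω) + S.H (S.keysOn U) :=
    entropy_prodMk_le hb hR (isRV_keysOn U)
  have h4 : S.H (fun ω (k : U) => S.W k ω) ≤ ((N - 1) * S.L : ℝ) := by
    have hc : Fintype.card (U → Fin S.L → F) = Fintype.card F ^ ((N - 1) * S.L) := by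
      simp [hU, ← pow_mul, mul_comm]
    refine (entropy_le_log_card hb hR).trans_eq ?_
    rw [log_card_div_log F hb hc, Nat.cast_mul, Nat.cast_sub (Nat.one_le_of_lt i.2), Nat.cast_one]
  rw [h1, H_inputs_view]
  linarith

/-- The functional dependencies of a decodable scheme, compared at two sample points. -/
structure Consistent (S : Scheme F net) (ω ω' : S.Ω) : Prop where
  sent_eq : ∀ i, S.W i ω = S.W i ω' → S.Z i ω = S.Z i ω' → ∀ j ∈ net i, S.X i j ω = S.X i j ω'
  relay_eq : ∀ j, (∀ i, j ∈ net i → S.X i j ω = S.X i j ω') → S.Y j ω = S.Y j ω'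
  sum_eq : (∀ j, S.Y j ω = S.Y j ω') → ∑ i, S.W i ω = ∑ i, S.W i ω'

/-- In a decodable scheme all the functional dependencies hold simultaneously off a null set. -/
lemma exists_ae_consistent (hS : S.Decodable) :
    ∃ G : Set S.Ω, (∀ᵐ ω ∂S.μ, ω ∈ G) ∧ ∀ ω ∈ G, ∀ ω' ∈ G, S.Consistent ω ω' := by
  have hb := one_lt_card F
  choose G₁ hG₁ h₁ using fun i => exists_ae_of_condEntropy_eq_zero hb (isRV_sent i)
    ((isRV_W i).prodMk (isRV_Z i)) (S.first_hop i)
  choose G₂ hG₂ h₂ using fun j => exists_ae_of_condEntropy_eq_zero hb (isRV_Y j)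
    (isRV_received j) (S.second_hop j)
  have hsum : IsRV fun ω => ∑ i, S.W i ω := isRV_inputs.comp fun w => ∑ i, w i
  obtain ⟨G₃, hG₃, h₃⟩ := exists_ae_of_condEntropy_eq_zero hb hsum (.pi isRV_Y) hS
  refine ⟨{ω | (∀ i, ω ∈ G₁ i) ∧ (∀ j, ω ∈ G₂ j) ∧ ω ∈ G₃}, ?_, ?_⟩
  · filter_upwards [ae_all_iff.2 hG₁, ae_all_iff.2 hG₂, hG₃] with ω a b c using ⟨a, b, c⟩
  · rintro ω ⟨a, b, c⟩ ω' ⟨a', b', c'⟩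
    refine ⟨fun i hW hZ => sent_eq_iff.1 (h₁ i ω (a i) ω' (a' i) (Prod.ext hW hZ)),
      fun j h => h₂ j ω (b j) ω' (b' j) (received_eq_iff.2 h), fun h => ?_⟩
    exact h₃ ω c ω' c' (funext h)

lemma Consistent.sent_eq_of_view {ω ω' : S.Ω} (h : S.Consistent ω ω') {U : Finset (Fin N)}
    (hV : S.view U ω = S.view U ω') {i : Fin N} (hi : i ∈ U) {j : Fin K} (hj : j ∈ net i) :
    S.X i j ω = S.X i j ω' :=
  have := view_eq_iff.1 hV i hi
  h.sent_eq i this.1 this.2 j hj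

/-- Given the inputs and keys of the other users, the messages of the relays that serve a user
determine its input: they complete the list of all relay messages, hence determine the sum. -/
lemma Consistent.input_eq {ω ω' : S.Ω} (h : S.Consistent ω ω') {i : Fin N}
    (hV : S.view (Finset.univ.erase i) ω = S.view (Finset.univ.erase i) ω')
    (hY : ∀ j ∈ net i, S.Y j ω = S.Y j ω') : S.W i ω = S.W i ω' := by
  have hsum := h.sum_eq fun j => by
    by_cases hj : j ∈ net i
    · exact hY j hj
    · exact h.relay_eq j fun k hk => h.sent_eq_of_view hV
        (Finset.mem_erase.2 ⟨fun e => hj (e ▸ hk), Finset.mem_univ k⟩) hk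
  rw [← Finset.add_sum_erase _ _ (Finset.mem_univ i),
    ← Finset.add_sum_erase _ _ (Finset.mem_univ i),
    Finset.sum_congr rfl fun k hk => (view_eq_iff.1 hV k hk).1] at hsum
  exact add_right_cancel hsum

lemma Consistent.relay_eq_of_sent {ω ω' : S.Ω} (h : S.Consistent ω ω') {i : Fin N}
    (hV : S.view (Finset.univ.erase i) ω = S.view (Finset.univ.erase i) ω')
    (hX : S.sent i ω = S.sent i ω') (j : Fin K) : S.Y j ω = S.Y j ω' :=
  h.relay_eq j fun k hk => by
    rcases eq_or_ne k i with rfl | hki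
    · exact sent_eq_iff.1 hX j hk
    · exact h.sent_eq_of_view hV (Finset.mem_erase.2 ⟨hki, Finset.mem_univ k⟩) hk

lemma L_add_H_view_le_relays (hS : S.Decodable) (i : Fin N) :
    S.L + S.H (S.view (Finset.univ.erase i)) ≤
      S.H (fun ω => ((fun (j : net i) => S.Y j ω), S.view (Finset.univ.erase i) ω)) := by
  obtain ⟨G, hG, hd⟩ := exists_ae_consistent hS
  have hY : IsRV fun ω (j : net i) => S.Y j ω := .pi fun j => isRV_Y j.1
  refine (L_add_H_view_le i).trans
    (entropy_le_of_ae (one_lt_card F) (hY.prodMk (isRV_view _)) hG fun ω hω ω' hω' h => ?_)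
  simp only [Prod.mk.injEq] at h ⊢
  exact ⟨(hd ω hω ω' hω').input_eq h.2 fun j hj => congrFun h.1 ⟨j, hj⟩, h.2⟩

lemma L_add_H_view_le_sent (hS : S.Decodable) (i : Fin N) :
    S.L + S.H (S.view (Finset.univ.erase i)) ≤
      S.H (fun ω => (S.sent i ω, S.view (Finset.univ.erase i) ω)) := by
  obtain ⟨G, hG, hd⟩ := exists_ae_consistent hS
  refine (L_add_H_view_le_relays hS i).trans
    (entropy_le_of_ae (one_lt_card F) ((isRV_sent i).prodMk (isRV_view _)) hG
      fun ω hω ω' hω' h => ?_)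
  simp only [Prod.mk.injEq] at h ⊢
  exact ⟨funext fun j => (hd ω hω ω' hω').relay_eq_of_sent h.2 h.1 j, h.2⟩

/-- If the messages of user `i` have total entropy at most `L`, they are determined by its input
together with the inputs and keys of the other users. -/
lemma H_sent_W_view_le (hS : S.Decodable) {i : Fin N} (hX : S.H (S.sent i) ≤ S.L) :
    S.H (fun ω => (S.sent i ω, S.W i ω, S.view (Finset.univ.erase i) ω)) ≤
      S.H (fun ω => (S.inputs ω, S.keysOn (Finset.univ.erase i) ω)) := by
  have hb := one_lt_card F
  obtain ⟨G, hG, hd⟩ := exists_ae_consistent hS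
  set V := S.view (Finset.univ.erase i)
  have hV : IsRV V := isRV_view _
  have h1 : S.H (fun ω => (S.sent i ω, S.W i ω, V ω)) ≤ S.H (fun ω => (S.sent i ω, V ω)) := by
    refine entropy_le_of_ae hb ((isRV_sent i).prodMk hV) hG fun ω hω ω' hω' h => ?_
    simp only [Prod.mk.injEq] at h ⊢
    have hc := hd ω hω ω' hω'
    exact ⟨h.1, hc.input_eq h.2 fun j _ => hc.relay_eq_of_sent h.2 h.1 j, h.2⟩
  have h2 : S.H (fun ω => (S.sent i ω, V ω)) ≤ S.H (S.sent i) + S.H V :=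
    entropy_prodMk_le hb (isRV_sent i) hV
  have h3 := L_add_H_view_le (S := S) i
  have h4 : S.H (fun ω => (S.W i ω, V ω)) ≤
      S.H (fun ω => (S.inputs ω, S.keysOn (Finset.univ.erase i) ω)) := by
    refine entropy_le_of_forall hb (isRV_inputs.prodMk (isRV_keysOn _)) fun ω ω' h => ?_
    simp only [Prod.mk.injEq, inputs_eq_iff, keysOn_eq_iff] at h
    exact Prod.ext (h.1 i) (view_eq_iff.2 fun k hk => ⟨h.1 k, h.2 k hk⟩)
  linarith

/-- Security at relay `j` forces keys: if `U` may collude with relay `j` and `M` is a part of what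
the relay receives, the uncertainty of `M` given the view of `U` must come from keys alone, as
the inputs do not reduce it. Hence any set `A` of users whose keys, together with all inputs,
determine `M` and the keys of `U` has at least that much additional key entropy. -/
lemma IsSecure.key_gap {Th T : ℕ} (hS : S.IsSecure Th T) (hTh : 1 ≤ Th) {j : Fin K}
    {U A : Finset (Fin N)} (hU : U.card ≤ T) {β : Type*} [Fintype β] {M : S.Ω → β} (hM : IsRV M)
    (hMj : ∀ ω ω', S.received j ω = S.received j ω' → M ω = M ω')
    (hA : S.H (fun ω => (S.inputs ω, M ω, S.view U ω)) ≤
      S.H (fun ω => (S.inputs ω, S.keysOn A ω))) :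
    S.H (fun ω => (M ω, S.view U ω)) - S.H (S.view U) ≤
      S.H (S.keysOn A) - S.H (S.keysOn U) := by
  have hb := one_lt_card F
  have hV : IsRV (S.view U) := isRV_view U
  have hR : IsRV (S.received j) := isRV_received j
  have hW : IsRV S.inputs := isRV_inputs
  have hsec := hS.2 {j} U (by simpa using hTh) hU
  have hR' : IsRV fun ω (j' : ({j} : Finset (Fin K))) (i : usersOf net j') => S.X i j' ω :=
    .pi fun j' => .pi fun i => isRV_X i.1 j'.1
  have hiff : ∀ ω ω', (fun (j' : ({j} : Finset (Fin K))) (i : usersOf net j') => S.X i j' ω) =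
      (fun (j' : ({j} : Finset (Fin K))) (i : usersOf net j') => S.X i j' ω') ↔
      S.received j ω = S.received j ω' := by
    intro ω ω'
    refine ⟨fun h => congrFun h ⟨j, Finset.mem_singleton_self j⟩, fun h => ?_⟩
    funext ⟨j', hj'⟩
    obtain rfl := Finset.mem_singleton.1 hj'
    exact h
  have hsec' : S.H (fun ω => (S.inputs ω, S.view U ω)) - S.H (S.view U) -
      (S.H (fun ω => (S.inputs ω, S.received j ω, S.view U ω)) -
        S.H (fun ω => (S.received j ω, S.view U ω))) = 0 := by
    have e1 : S.H (fun ω => (S.received j ω, S.view U ω)) = S.H (fun ω =>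
        ((fun (j' : ({j} : Finset (Fin K))) (i : usersOf net j') => S.X i j' ω), S.view U ω)) :=
      entropy_congr hb (hR.prodMk hV) (hR'.prodMk hV) fun ω ω' => by
        rw [Prod.mk.injEq, Prod.mk.injEq, hiff]
    have e2 : S.H (fun ω => (S.inputs ω, S.received j ω, S.view U ω)) =
        S.H (fun ω => (S.inputs ω,
          (fun (j' : ({j} : Finset (Fin K))) (i : usersOf net j') => S.X i j' ω), S.view U ω)) :=
      entropy_congr hb (hW.prodMk (hR.prodMk hV)) (hW.prodMk (hR'.prodMk hV)) fun ω ω' => by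
        rw [Prod.mk.injEq, Prod.mk.injEq, Prod.mk.injEq, Prod.mk.injEq, hiff]
    rw [e1, e2]
    exact hsec
  have h1 : S.H (fun ω => (S.inputs ω, S.received j ω, S.view U ω)) -
        S.H (fun ω => (S.received j ω, S.view U ω)) ≤
      S.H (fun ω => (S.inputs ω, M ω, S.view U ω)) - S.H (fun ω => (M ω, S.view U ω)) :=
    condEntropy_anti hb hW (hR.prodMk hV) (hM.prodMk hV) (G := Set.univ) (by simp)
      fun ω _ ω' _ h => by
        rw [Prod.mk.injEq] at h
        exact Prod.ext (hMj ω ω' h.1) h.2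
  have h2 := H_inputs_view (S := S) U
  rw [H_inputs_keysOn] at hA
  linarith

/-! ### Lower bounds for the cyclic network -/

section Cyclic

variable {F : Type u} [Field F] [Fintype F] {N : ℕ} [NeZero N]

omit [NeZero N] in
lemma L_pos_real (S : Scheme F (cyclicNetwork N 2)) : (0 : ℝ) < S.L := by exact_mod_cast S.L_pos

lemma val_one_of_two_le (hN : 2 ≤ N) : ((1 : Fin N) : ℕ) = 1 := by
  rw [Fin.val_one', Nat.mod_eq_of_lt (by omega)]

lemma mem_cyclicNetwork_two (hN : 3 ≤ N) {i j : Fin N} :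
    j ∈ cyclicNetwork N 2 i ↔ j = i ∨ j = i - 1 := by
  have h1 := val_one_of_two_le (N := N) (by omega)
  have h2 : ((j : ℕ) + 1) % N = i ↔ j = i - 1 := by
    rw [eq_sub_iff_add_eq, Fin.ext_iff, Fin.val_add, h1]
  simp only [cyclicNetwork, Finset.mem_filter, Finset.mem_univ, true_and, Finset.mem_range]
  constructor
  · rintro ⟨p, hp, h⟩
    interval_cases p
    · left; rw [add_zero, Nat.mod_eq_of_lt j.2] at h; exact Fin.ext h
    · right; exact h2.1 h
  · rintro (h | h)
    · exact ⟨0, by norm_num, by rw [add_zero, Nat.mod_eq_of_lt j.2, h]⟩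
    · exact ⟨1, by norm_num, h2.2 h⟩

lemma self_mem_cyclicNetwork (hN : 3 ≤ N) (i : Fin N) : i ∈ cyclicNetwork N 2 i :=
  (mem_cyclicNetwork_two hN).2 (.inl rfl)

lemma mem_cyclicNetwork_add_one (hN : 3 ≤ N) (j : Fin N) : j ∈ cyclicNetwork N 2 (j + 1) :=
  (mem_cyclicNetwork_two hN).2 (.inr (add_sub_cancel_right j 1).symm)

lemma exists_other_relay (hN : 3 ≤ N) {i j : Fin N} (hj : j ∈ cyclicNetwork N 2 i) :
    ∃ j' ∈ cyclicNetwork N 2 i, ∀ k ∈ cyclicNetwork N 2 i, k = j ∨ k = j' := by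
  simp only [mem_cyclicNetwork_two hN] at *
  rcases hj with rfl | rfl
  · exact ⟨j - 1, .inr rfl, fun k hk => hk⟩
  · exact ⟨i, .inl rfl, fun k hk => hk.symm⟩

variable {S : Scheme F (cyclicNetwork N 2)}

omit [NeZero N] in
lemma H_X_le_RX {i j : Fin N} (hj : j ∈ cyclicNetwork N 2 i) : S.H (S.X i j) ≤ S.RX * S.L := by
  rw [← div_le_iff₀ (L_pos_real S)]
  exact le_ciSup (f := fun e : {e : Fin N × Fin N // e.2 ∈ cyclicNetwork N 2 e.1} =>
    S.H (S.X e.1.1 e.1.2) / S.L) (Set.finite_range _).bddAbove ⟨(i, j), hj⟩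

omit [NeZero N] in
lemma H_Y_le_RY (j : Fin N) : S.H (S.Y j) ≤ S.RY * S.L := by
  rw [← div_le_iff₀ (L_pos_real S)]
  exact le_ciSup (f := fun j : Fin N => S.H (S.Y j) / S.L) (Set.finite_range _).bddAbove j

/-- A family indexed by the two relays of user `i` has at most the sum of the entropies. -/
lemma H_relays_le (hN : 3 ≤ N) (i : Fin N) {β : Type*} [Fintype β] {M : Fin N → S.Ω → β}
    (hM : ∀ j, IsRV (M j)) :
    S.H (fun ω (j : cyclicNetwork N 2 i) => M j ω) ≤ S.H (M i) + S.H (M (i - 1)) := by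
  refine (entropy_le_of_forall (one_lt_card F) ((hM i).prodMk (hM (i - 1))) ?_).trans
    (entropy_prodMk_le (one_lt_card F) (hM i) (hM (i - 1)))
  intro ω ω' h
  rw [Prod.mk.injEq] at h
  funext ⟨j, hj⟩
  rcases (mem_cyclicNetwork_two hN).1 hj with rfl | rfl
  exacts [h.1, h.2]

lemma half_le_RX (hN : 3 ≤ N) (hS : S.Decodable) : 1 / 2 ≤ S.RX := by
  have h1 := L_add_H_view_le_sent hS 0
  have h2 : S.H (fun ω => (S.sent 0 ω, S.view (Finset.univ.erase 0) ω)) ≤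
    S.H (S.sent 0) + S.H (S.view (Finset.univ.erase 0)) :=
    entropy_prodMk_le (one_lt_card F) (isRV_sent 0) (isRV_view _)
  have h3 : S.H (S.sent 0) ≤ _ := H_relays_le hN 0 fun j => isRV_X 0 j
  have h4 := H_X_le_RX (S := S) (self_mem_cyclicNetwork hN 0)
  have h5 := H_X_le_RX (S := S) ((mem_cyclicNetwork_two hN (i := 0)).2 (.inr rfl))
  have h6 := L_pos_real S
  nlinarith

lemma half_le_RY (hN : 3 ≤ N) (hS : S.Decodable) : 1 / 2 ≤ S.RY := by
  have hY : IsRV fun ω (j : cyclicNetwork N 2 0) => S.Y j ω := .pi fun j => isRV_Y j.1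
  have h1 := L_add_H_view_le_relays hS 0
  have h2 : S.H (fun ω => ((fun (j : cyclicNetwork N 2 0) => S.Y j ω),
      S.view (Finset.univ.erase 0) ω)) ≤ S.H (fun ω (j : cyclicNetwork N 2 0) => S.Y j ω) +
      S.H (S.view (Finset.univ.erase 0)) :=
    entropy_prodMk_le (one_lt_card F) hY (isRV_view _)
  have h3 : S.H (fun ω (j : cyclicNetwork N 2 0) => S.Y j ω) ≤ _ :=
    H_relays_le hN 0 fun j => isRV_Y j
  have h4 := H_Y_le_RY (S := S) 0
  have h5 := H_Y_le_RY (S := S) (0 - 1)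
  have h6 := L_pos_real S
  nlinarith

lemma H_sent_le (hN : 3 ≤ N) (hX : S.RX = 1 / 2) (i : Fin N) : S.H (S.sent i) ≤ S.L := by
  have h3 : S.H (S.sent i) ≤ _ := H_relays_le hN i fun j => isRV_X i j
  have h4 := H_X_le_RX (S := S) (self_mem_cyclicNetwork hN i)
  have h5 := H_X_le_RX (S := S) ((mem_cyclicNetwork_two hN (i := i)).2 (.inr rfl))
  rw [hX] at h4 h5
  linarith

/-- With optimal loads each message has conditional entropy `L / 2` given anything that is
determined by the inputs and keys of the other users. -/
lemma message_gap (hN : 3 ≤ N) (hS : S.Decodable) (hX : S.RX = 1 / 2) {i j : Fin N}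
    (hj : j ∈ cyclicNetwork N 2 i) {β : Type*} [Fintype β] {B : S.Ω → β} (hB : IsRV B)
    (h : ∀ ω ω', S.Consistent ω ω' →
      S.view (Finset.univ.erase i) ω = S.view (Finset.univ.erase i) ω' → B ω = B ω') :
    S.L / 2 ≤ S.H (fun ω => (S.X i j ω, B ω)) - S.H B := by
  have hb := one_lt_card F
  obtain ⟨G, hG, hd⟩ := exists_ae_consistent hS
  set V := S.view (Finset.univ.erase i)
  have hV : IsRV V := isRV_view _
  have h1 : S.H (fun ω => (S.X i j ω, V ω)) - S.H V ≤
      S.H (fun ω => (S.X i j ω, B ω)) - S.H B :=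
    condEntropy_anti hb (isRV_X i j) hV hB hG fun ω hω ω' hω' => h ω ω' (hd ω hω ω' hω')
  obtain ⟨j', hj', hjj'⟩ := exists_other_relay hN hj
  have h2 : S.H (fun ω => (S.sent i ω, V ω)) ≤
      S.H (fun ω => (S.X i j' ω, S.X i j ω, V ω)) :=
    entropy_le_of_forall hb ((isRV_X i j').prodMk ((isRV_X i j).prodMk hV)) fun ω ω' h => by
      simp only [Prod.mk.injEq] at h ⊢
      refine ⟨sent_eq_iff.2 fun k hk => ?_, h.2.2⟩
      rcases hjj' k hk with rfl | rfl
      exacts [h.2.1, h.1]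
  have h3 : S.H (fun ω => (S.X i j' ω, S.X i j ω, V ω)) ≤
      S.H (S.X i j') + S.H (fun ω => (S.X i j ω, V ω)) :=
    entropy_prodMk_le hb (isRV_X i j') ((isRV_X i j).prodMk hV)
  have h4 := H_X_le_RX (S := S) hj'
  have h5 : S.L + S.H V ≤ S.H (fun ω => (S.sent i ω, V ω)) := L_add_H_view_le_sent hS i
  rw [hX] at h4
  linarith

omit [NeZero N] in
lemma view_eq_of_subset {U A : Finset (Fin N)} (hUA : U ⊆ A) {ω ω' : S.Ω}
    (h : S.view A ω = S.view A ω') : S.view U ω = S.view U ω' :=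
  view_eq_iff.2 fun i hi => view_eq_iff.1 h i (hUA hi)

lemma one_message_gap (hN : 3 ≤ N) (hS : S.Decodable) (hX : S.RX = 1 / 2) {i j : Fin N}
    (hj : j ∈ cyclicNetwork N 2 i) {U : Finset (Fin N)} (hi : i ∉ U) :
    S.L / 2 ≤ S.H (fun ω => (S.X i j ω, S.view U ω)) - S.H (S.view U) :=
  message_gap hN hS hX hj (isRV_view U) fun _ _ _ h =>
    view_eq_of_subset (Finset.subset_erase.2 ⟨Finset.subset_univ U, hi⟩) h

/-- The messages to one relay from two users outside `U` have joint conditional entropy `L` given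
the view of `U`, as each of them has entropy `L / 2` even given the whole view of the other user. -/
lemma two_message_gap (hN : 3 ≤ N) (hS : S.Decodable) (hX : S.RX = 1 / 2) {i k j : Fin N}
    (hik : i ≠ k) (hj : j ∈ cyclicNetwork N 2 i) (hj' : j ∈ cyclicNetwork N 2 k)
    {U : Finset (Fin N)} (hi : i ∉ U) (hk : k ∉ U) :
    S.L ≤ S.H (fun ω => ((S.X k j ω, S.X i j ω), S.view U ω)) - S.H (S.view U) := by
  have h1 := one_message_gap hN hS hX hj hi
  have hB : IsRV fun ω => (S.X i j ω, S.view U ω) := (isRV_X i j).prodMk (isRV_view U)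
  have h2 := message_gap hN hS hX hj' hB fun ω ω' hc h =>
    Prod.ext (hc.sent_eq_of_view h (Finset.mem_erase.2 ⟨hik, Finset.mem_univ i⟩) hj)
      (view_eq_of_subset (Finset.subset_erase.2 ⟨Finset.subset_univ U, hk⟩) h)
  have h3 : S.H (fun ω => (S.X k j ω, S.X i j ω, S.view U ω)) =
      S.H (fun ω => ((S.X k j ω, S.X i j ω), S.view U ω)) :=
    entropy_congr (one_lt_card F) ((isRV_X k j).prodMk hB)
      (((isRV_X k j).prodMk (isRV_X i j)).prodMk (isRV_view U)) fun ω ω' => by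
        simp only [Prod.mk.injEq, and_assoc]
  linarith

/-- The key of a user outside the colluding set has conditional entropy at least `L / 2` given the
keys of that set. -/
lemma key_gap_one (hN : 3 ≤ N) {T : ℕ} (hS : S.IsSecure 1 T) (hX : S.RX = 1 / 2) {i : Fin N}
    {U : Finset (Fin N)} (hU : U.card ≤ T) (hi : i ∉ U) :
    S.L / 2 ≤ S.H (S.keysOn (insert i U)) - S.H (S.keysOn U) := by
  obtain ⟨G, hG, hd⟩ := exists_ae_consistent hS.1
  have hii := self_mem_cyclicNetwork hN i
  refine (one_message_gap hN hS.1 hX hii hi).trans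
    (hS.key_gap le_rfl hU (isRV_X i i) (j := i) (fun ω ω' h => received_eq_iff.1 h i hii) ?_)
  refine entropy_le_of_ae (one_lt_card F) (isRV_inputs.prodMk (isRV_keysOn _)) hG
    fun ω hω ω' hω' h => ?_
  simp only [Prod.mk.injEq, inputs_eq_iff, keysOn_eq_iff] at h ⊢
  exact ⟨h.1, (hd ω hω ω' hω').sent_eq i (h.1 i) (h.2 i (Finset.mem_insert_self i U)) i hii,
    view_eq_iff.2 fun k hk => ⟨h.1 k, h.2 k (Finset.mem_insert_of_mem hk)⟩⟩

/-- The keys of two users of one relay, both outside the colluding set, have conditional entropy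
at least `L` given the keys of that set. -/
lemma key_gap_two (hN : 3 ≤ N) {T : ℕ} (hS : S.IsSecure 1 T) (hX : S.RX = 1 / 2) {i : Fin N}
    {U : Finset (Fin N)} (hU : U.card ≤ T) (hi : i ∉ U) (hi' : i + 1 ∉ U) (hne : i ≠ i + 1) :
    S.L ≤ S.H (S.keysOn (insert i (insert (i + 1) U))) - S.H (S.keysOn U) := by
  obtain ⟨G, hG, hd⟩ := exists_ae_consistent hS.1
  have hii := self_mem_cyclicNetwork hN i
  have hii' := mem_cyclicNetwork_add_one hN i
  refine (two_message_gap hN hS.1 hX hne hii hii' hi hi').trans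
    (hS.key_gap le_rfl hU ((isRV_X (i + 1) i).prodMk (isRV_X i i)) (j := i)
      (fun ω ω' h => Prod.ext (received_eq_iff.1 h _ hii') (received_eq_iff.1 h i hii)) ?_)
  refine entropy_le_of_ae (one_lt_card F) (isRV_inputs.prodMk (isRV_keysOn _)) hG
    fun ω hω ω' hω' h => ?_
  simp only [Prod.mk.injEq, inputs_eq_iff, keysOn_eq_iff] at h ⊢
  have hc := hd ω hω ω' hω'
  exact ⟨h.1, ⟨hc.sent_eq _ (h.1 _) (h.2 _ (by simp)) i hii',
    hc.sent_eq i (h.1 i) (h.2 i (by simp)) i hii⟩,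
    view_eq_iff.2 fun k hk => ⟨h.1 k, h.2 k (by simp [hk])⟩⟩

/-- If all users except `i` and `i + 1` may collude, the key of user `i` has conditional entropy
at least `L` given their keys: the message of user `i + 1` to the common relay is no new
uncertainty, since it is determined by all inputs and the keys of the users other than `i + 1`. -/
lemma key_gap_of_erase_two (hN : 3 ≤ N) {T : ℕ} (hS : S.IsSecure 1 T) (hX : S.RX = 1 / 2)
    {i : Fin N} (hU : ((Finset.univ.erase (i + 1)).erase i).card ≤ T) (hne : i ≠ i + 1) :
    S.L ≤ S.H (S.keysOn (Finset.univ.erase (i + 1))) -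
      S.H (S.keysOn ((Finset.univ.erase (i + 1)).erase i)) := by
  obtain ⟨G, hG, hd⟩ := exists_ae_consistent hS.1
  have hii := self_mem_cyclicNetwork hN i
  have hii' := mem_cyclicNetwork_add_one hN i
  refine (two_message_gap hN hS.1 hX hne hii hii' (by simp) (by simp)).trans
    (hS.key_gap le_rfl hU ((isRV_X (i + 1) i).prodMk (isRV_X i i)) (j := i)
      (fun ω ω' h => Prod.ext (received_eq_iff.1 h _ hii') (received_eq_iff.1 h i hii)) ?_)
  refine le_trans ?_ (H_sent_W_view_le hS.1 (H_sent_le hN hX (i + 1)))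
  refine entropy_le_of_ae (one_lt_card F)
    ((isRV_sent _).prodMk ((isRV_W _).prodMk (isRV_view _))) hG fun ω hω ω' hω' h => ?_
  simp only [Prod.mk.injEq, inputs_eq_iff] at h ⊢
  refine ⟨fun k => ?_, ⟨sent_eq_iff.1 h.1 i hii', (hd ω hω ω' hω').sent_eq_of_view h.2.2
    (Finset.mem_erase.2 ⟨hne, Finset.mem_univ i⟩) hii⟩,
    view_eq_of_subset (Finset.erase_subset _ _) h.2.2⟩
  rcases eq_or_ne k (i + 1) with rfl | hk
  · exact h.2.1
  · exact (view_eq_iff.1 h.2.2 k (by simp [hk])).1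

/-- If all users except one may collude, the message of that user to a relay would be independent
of its input given the rest, but the input and the rest determine the message. -/
lemma not_isSecure_of_le (hN : 3 ≤ N) {T : ℕ} (hT : N ≤ T + 1) (hS : S.IsSecure 1 T) :
    S.RX ≠ 1 / 2 := by
  intro hX
  have h00 := self_mem_cyclicNetwork hN 0
  have hU : (Finset.univ.erase (0 : Fin N)).card ≤ T := by simp; omega
  have h := (one_message_gap hN hS.1 hX h00 (by simp)).trans
    (hS.key_gap le_rfl hU (isRV_X 0 0) (j := 0) (A := Finset.univ.erase 0)
      (fun ω ω' h => received_eq_iff.1 h 0 h00) ?_)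
  · have := L_pos_real S
    linarith
  · refine le_trans ?_ (H_sent_W_view_le hS.1 (H_sent_le hN hX 0))
    refine entropy_le_of_forall (one_lt_card F)
      ((isRV_sent _).prodMk ((isRV_W _).prodMk (isRV_view _))) fun ω ω' h => ?_
    simp only [Prod.mk.injEq, inputs_eq_iff] at h ⊢
    refine ⟨fun k => ?_, sent_eq_iff.1 h.1 0 h00, h.2.2⟩
    rcases eq_or_ne k 0 with rfl | hk
    · exact h.2.1
    · exact (view_eq_iff.1 h.2.2 k (by simp [hk])).1

omit [NeZero N] in
lemma H_keysOn_le_LZSigma (U : Finset (Fin N)) : S.H (S.keysOn U) ≤ S.LZSigma :=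
  entropy_le_of_forall (one_lt_card F) (.pi isRV_Z) fun _ _ e =>
    keysOn_eq_iff.2 fun i _ => congrFun e i

omit [NeZero N] in
lemma H_keysOn_nonneg (U : Finset (Fin N)) : 0 ≤ S.H (S.keysOn U) := by
  refine Finset.sum_nonneg fun a _ => div_nonneg ?_ (Real.log_pos (one_lt_card F)).le
  exact Real.negMulLog_nonneg measureReal_nonneg measureReal_le_one

omit [NeZero N] in
lemma H_Z_le (i : Fin N) : S.H (S.Z i) ≤ S.LZ := by
  refine (entropy_le_log_card (one_lt_card F) (isRV_Z i)).trans_eq ?_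
  exact log_card_div_log F (one_lt_card F) (by simp)

omit [NeZero N] in
/-- Additional key entropy of one more user decreases with the set of known keys. -/
lemma H_keysOn_insert_sub_anti {U A : Finset (Fin N)} (h : U ⊆ A) (i : Fin N) :
    S.H (S.keysOn (insert i A)) - S.H (S.keysOn A) ≤
      S.H (S.keysOn (insert i U)) - S.H (S.keysOn U) := by
  have hins : ∀ U : Finset (Fin N), S.H (S.keysOn (insert i U)) =
      S.H (fun ω => (S.Z i ω, S.keysOn U ω)) := fun U =>
    entropy_congr (one_lt_card F) (isRV_keysOn _) ((isRV_Z i).prodMk (isRV_keysOn U))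
      fun ω ω' => by simp [keysOn_eq_iff]
  rw [hins, hins]
  exact condEntropy_anti (one_lt_card F) (isRV_Z i) (isRV_keysOn A) (isRV_keysOn U)
    (G := Set.univ) (by simp) fun ω _ ω' _ e =>
      keysOn_eq_iff.2 fun i hi => keysOn_eq_iff.1 e i (h hi)

omit [NeZero N] in
lemma key_gap_le_LZ {U : Finset (Fin N)} (i : Fin N) :
    S.H (S.keysOn (insert i U)) - S.H (S.keysOn U) ≤ S.LZ := by
  have h := (S.H_keysOn_insert_sub_anti (Finset.empty_subset U) i)
  have h0 := H_keysOn_nonneg (S := S) ∅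
  have h1 : S.H (S.keysOn (insert i ∅)) ≤ S.H (S.Z i) :=
    entropy_le_of_forall (one_lt_card F) (isRV_Z i) fun ω ω' e => by simpa [keysOn_eq_iff] using e
  have h2 := H_Z_le (S := S) i
  linarith

/-- The users `0, …, k - 1`. -/
def initialUsers (N k : ℕ) : Finset (Fin N) := Finset.univ.filter fun i => (i : ℕ) < k

omit [NeZero N] in
lemma initialUsers_succ {k : ℕ} (hk : k < N) :
    initialUsers N (k + 1) = insert ⟨k, hk⟩ (initialUsers N k) := by
  ext i
  simp [initialUsers, Fin.ext_iff]
  omega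

omit [NeZero N] in
lemma card_initialUsers {k : ℕ} (hk : k ≤ N) : (initialUsers N k).card = k := by
  induction k with
  | zero => simp [initialUsers]
  | succ k ih =>
    rw [initialUsers_succ hk, Finset.card_insert_of_notMem (by simp [initialUsers]),
      ih (by omega)]

lemma mk_add_one {k : ℕ} (hk : k + 1 < N) :
    (⟨k, by omega⟩ : Fin N) + 1 = ⟨k + 1, hk⟩ := by
  have h1 := val_one_of_two_le (N := N) (by omega)
  ext
  rw [Fin.val_add, h1]
  exact Nat.mod_eq_of_lt hk

omit [NeZero N] in
/-- The chain rule for the keys of the first `m` users. -/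
lemma mul_le_H_keysOn_initialUsers {c : ℝ} {m : ℕ} (hm : m ≤ N)
    (h : ∀ k (hk : k < m), c ≤ S.H (S.keysOn (insert ⟨k, by omega⟩ (initialUsers N k))) -
      S.H (S.keysOn (initialUsers N k))) :
    m * c ≤ S.H (S.keysOn (initialUsers N m)) := by
  induction m with
  | zero => simpa using H_keysOn_nonneg _
  | succ m ih =>
    have h1 := ih (by omega) fun k hk => h k (by omega)
    have h2 := h m (by omega)
    rw [initialUsers_succ hm]
    push_cast
    linarith

/-- The chain `Z_1, …, Z_T` contributes `L / 2` per key, and two further users of one relay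
contribute `L` together. -/
lemma key_rates_of_le (hN : 3 ≤ N) {T : ℕ} (hT : T + 3 ≤ N) (hS : IsCommOptimalSecure T S) :
    1 / 2 ≤ S.RZ ∧ (T : ℝ) / 2 + 1 ≤ S.RZSigma := by
  obtain ⟨hS, hX, -⟩ := hS
  have hL := L_pos_real S
  constructor
  · have h1 := key_gap_one hN hS hX (i := 0) (U := ∅) (by simp) (by simp)
    have h2 := key_gap_le_LZ (S := S) (U := ∅) 0
    rw [RZ, le_div_iff₀ hL]
    linarith
  · have h1 : T * ((S.L : ℝ) / 2) ≤ S.H (S.keysOn (initialUsers N T)) :=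
      mul_le_H_keysOn_initialUsers (by omega) fun k hk =>
        key_gap_one hN hS hX (by rw [card_initialUsers (by omega)]; omega)
          (by simp [initialUsers])
    have h2 := key_gap_two hN hS hX (i := ⟨T, by omega⟩) (U := initialUsers N T)
      (by rw [card_initialUsers (by omega)]) (by simp [initialUsers])
      (by rw [mk_add_one (by omega)]; simp [initialUsers])
      (by rw [mk_add_one (by omega)]; simp)
    have h3 := H_keysOn_le_LZSigma (S := S)
      (insert ⟨T, by omega⟩ (insert ((⟨T, by omega⟩ : Fin N) + 1) (initialUsers N T)))
    rw [RZSigma, le_div_iff₀ hL]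
    linarith

/-- Each key but the last contributes `L` in the chain `Z_1, …, Z_{N-1}`, because the preceding
users are among those other than `i` and `i + 1`. -/
lemma key_rates_of_eq (hN : 3 ≤ N) {T : ℕ} (hT : T + 2 = N) (hS : IsCommOptimalSecure T S) :
    1 ≤ S.RZ ∧ (N : ℝ) - 1 ≤ S.RZSigma := by
  obtain ⟨hS, hX, -⟩ := hS
  have hL := L_pos_real S
  have hgap : ∀ k (hk : k < N - 1),
      S.L ≤ S.H (S.keysOn (insert ⟨k, by omega⟩ (initialUsers N k))) -
        S.H (S.keysOn (initialUsers N k)) := by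
    intro k hk
    have hadd := mk_add_one (N := N) (k := k) (by omega)
    have hne : (⟨k, by omega⟩ : Fin N) ≠ ⟨k, by omega⟩ + 1 := by rw [hadd]; simp
    have hmem : (⟨k, by omega⟩ : Fin N) ∈ Finset.univ.erase ((⟨k, by omega⟩ : Fin N) + 1) :=
      Finset.mem_erase.2 ⟨hne, Finset.mem_univ _⟩
    have h1 := key_gap_of_erase_two hN hS hX (i := ⟨k, by omega⟩)
      (by rw [Finset.card_erase_of_mem hmem, Finset.card_erase_of_mem (Finset.mem_univ _)]
          simp; omega) hne
    rw [← Finset.insert_erase hmem, Finset.erase_insert (Finset.notMem_erase _ _)] at h1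
    refine h1.trans (H_keysOn_insert_sub_anti (fun i hi => ?_) _)
    simp only [initialUsers, Finset.mem_filter, Finset.mem_univ, true_and] at hi
    simp only [hadd, Finset.mem_erase, Finset.mem_univ, and_true, ne_eq, Fin.ext_iff]
    omega
  constructor
  · have h1 := hgap 0 (by omega)
    have h2 := key_gap_le_LZ (S := S) (U := initialUsers N 0) ⟨0, by omega⟩
    rw [RZ, le_div_iff₀ hL]
    linarith
  · have h1 := mul_le_H_keysOn_initialUsers (by omega) hgap
    have h2 := H_keysOn_le_LZSigma (S := S) (initialUsers N (N - 1))
    rw [Nat.cast_sub (by omega), Nat.cast_one] at h1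
    rw [RZSigma, le_div_iff₀ hL]
    linarith

end Cyclic
end Scheme

/-! ### The uniform distribution on a finite type -/

section Uniform

/-- The uniform distribution on a finite type, all of whose subsets are events. -/
noncomputable def uniformMeasure (Ω : Type*) [Fintype Ω] [Nonempty Ω] : @Measure Ω ⊤ :=
  @PMF.toMeasure Ω ⊤ (PMF.uniformOfFintype Ω)

variable {Ω : Type*} [Fintype Ω] [Nonempty Ω]

instance : @IsProbabilityMeasure Ω ⊤ (uniformMeasure Ω) :=
  @PMF.toMeasure.isProbabilityMeasure Ω ⊤ (PMF.uniformOfFintype Ω)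

lemma uniformMeasure_real (s : Set Ω) :
    @Measure.real Ω ⊤ (uniformMeasure Ω) s = Nat.card s / Fintype.card Ω := by
  classical
  let _ : MeasurableSpace Ω := ⊤
  rw [Measure.real, uniformMeasure, PMF.toMeasure_uniformOfFintype_apply s trivial]
  simp [Nat.card_eq_fintype_card]

/-- A surjective homomorphism maps the uniform distribution to the uniform distribution. -/
lemma uniformMeasure_real_preimage_of_surjective {Ω B : Type*} [AddGroup Ω] [Fintype Ω]
    [AddGroup B] [Fintype B] (f : Ω →+ B) (hf : Function.Surjective f) (c : B) :
    @Measure.real Ω ⊤ (uniformMeasure Ω) (f ⁻¹' {c}) = 1 / Fintype.card B := by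
  classical
  have hfib : ∀ c', Nat.card (f ⁻¹' {c'}) = Nat.card (f ⁻¹' {c}) := by
    intro c'
    have := AddMonoidHom.card_fiber_eq_of_mem_range f (hf c') (hf c)
    simpa [Nat.card_eq_fintype_card, Fintype.card_subtype] using this
  have hcard : Fintype.card Ω = Fintype.card B * Nat.card (f ⁻¹' {c}) := by
    rw [← Nat.card_eq_fintype_card, ← Nat.card_congr (Equiv.sigmaFiberEquiv f), Nat.card_sigma]
    exact (Finset.sum_congr rfl fun c' _ => hfib c').trans
      (by rw [Finset.sum_const, Finset.card_univ, smul_eq_mul])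
  have hΩ : (Fintype.card Ω : ℝ) ≠ 0 := by exact_mod_cast Fintype.card_ne_zero
  rw [uniformMeasure_real]
  rw [hcard, Nat.cast_mul] at hΩ ⊢
  rw [div_eq_div_iff hΩ (left_ne_zero_of_mul hΩ)]
  ring

end Uniform

namespace Scheme

/-! ### A linear scheme over the cyclic network -/

section Linear

variable {F : Type u} [Field F] {N : ℕ} [NeZero N] {E : Type u} [Field E] [Algebra F E]

/-- The relay of user `i` in the cyclic network other than its relay `j`. -/
def otherRelay (i j : Fin N) : Fin N := if j = i then i - 1 else i

/-- The coordinate of `v : E × E` at `(1, x j)` with respect to the basis `(1, x j)`, `(1, x j')`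
of `E × E`, where `j` and `j'` are the two relays of user `i`. -/
def encode (F : Type u) [Field F] [Algebra F E] (x : Fin N → E) (i j : Fin N) : E × E →ₗ[F] E where
  toFun v := (x j - x (otherRelay i j))⁻¹ * (v.2 - x (otherRelay i j) * v.1)
  map_add' v w := by simp; ring
  map_smul' a v := by
    simp only [Prod.smul_snd, Prod.smul_fst, mul_smul_comm, ← smul_sub, RingHom.id_apply]

lemma encode_apply (x : Fin N → E) (i j : Fin N) (v : E × E) : encode F x i j v =
    (x j - x (otherRelay i j))⁻¹ * (v.2 - x (otherRelay i j) * v.1) := rfl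

lemma sub_one_ne (hN : 3 ≤ N) (i : Fin N) : i - 1 ≠ i := by
  simp only [ne_eq, sub_eq_self]
  intro h
  have := congrArg Fin.val h
  rw [val_one_of_two_le (by omega)] at this
  simp at this

/-- The two messages of a user are the coordinates of the vector that it sends. -/
lemma sum_encode (hN : 3 ≤ N) {x : Fin N → E} (hx : Function.Injective x) (i : Fin N) (v : E × E) :
    ∑ j ∈ cyclicNetwork N 2 i, (encode F x i j v, x j * encode F x i j v) = v := by
  have hne := sub_one_ne hN i
  have hnet : cyclicNetwork N 2 i = {i, i - 1} := by
    ext j; simp [mem_cyclicNetwork_two hN]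
  have h1 : x i - x (i - 1) ≠ 0 := sub_ne_zero.2 fun h => hne (hx h).symm
  have h2 : x (i - 1) - x i ≠ 0 := sub_ne_zero.2 fun h => hne (hx h)
  have h3 : x (i - 1) - x i = -(x i - x (i - 1)) := by ring
  rw [hnet, Finset.sum_pair hne.symm]
  simp only [encode_apply, otherRelay, if_true, hne, if_false, h3]
  ext
  · simp only [Prod.fst_add, inv_neg]
    field_simp
    ring
  · simp only [Prod.snd_add, inv_neg]
    field_simp
    ring

variable {𝒮 𝒦 : Type u} [AddCommGroup 𝒮] [Module F 𝒮] [AddCommGroup 𝒦]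
  [Module F 𝒦]

/-- The message of user `i` to relay `j`: the coordinate of the input masked by `c (k i s)`. -/
def linearMessage (x : Fin N → E) (c : 𝒦 →ₗ[F] E × E) (k : Fin N → 𝒮 →ₗ[F] 𝒦) {L m : ℕ}
    (eW : (Fin L → F) ≃ₗ[F] E × E) (eS : (Fin m → F) ≃ₗ[F] 𝒮) (i j : Fin N)
    (ω : (Fin N → Fin L → F) × (Fin m → F)) : E :=
  encode F x i j (eW (ω.1 i) + c (k i (eS ω.2)))

/-- The message of relay `j`: the sum of what it receives. -/
def linearRelay (x : Fin N → E) (c : 𝒦 →ₗ[F] E × E) (k : Fin N → 𝒮 →ₗ[F] 𝒦) {L m : ℕ}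
    (eW : (Fin L → F) ≃ₗ[F] E × E) (eS : (Fin m → F) ≃ₗ[F] 𝒮) (j : Fin N)
    (ω : (Fin N → Fin L → F) × (Fin m → F)) : E :=
  ∑ i ∈ usersOf (cyclicNetwork N 2) j, linearMessage x c k eW eS i j ω

/-- Decoding: the relay messages are the coefficients of the sum of the inputs in terms of the
vectors `(1, x j)`, because the masks cancel. -/
lemma map_sum_eq_sum_linearRelay (hN : 3 ≤ N) {x : Fin N → E} (hx : Function.Injective x)
    {c : 𝒦 →ₗ[F] E × E} {k : Fin N → 𝒮 →ₗ[F] 𝒦} (hsum : ∀ s, ∑ i, c (k i s) = 0) {L m : ℕ}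
    (eW : (Fin L → F) ≃ₗ[F] E × E) (eS : (Fin m → F) ≃ₗ[F] 𝒮)
    (ω : (Fin N → Fin L → F) × (Fin m → F)) : eW (∑ i, ω.1 i) =
      ∑ j, (linearRelay x c k eW eS j ω, x j * linearRelay x c k eW eS j ω) := by
  have h1 : ∀ j, (linearRelay x c k eW eS j ω, x j * linearRelay x c k eW eS j ω) =
      ∑ i ∈ usersOf (cyclicNetwork N 2) j,
        (linearMessage x c k eW eS i j ω, x j * linearMessage x c k eW eS i j ω) := by
    intro j
    rw [Prod.ext_iff, Prod.fst_sum, Prod.snd_sum]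
    exact ⟨rfl, Finset.mul_sum _ _ _⟩
  rw [Finset.sum_congr rfl fun j _ => h1 j,
    Finset.sum_comm' (t' := Finset.univ) (s' := fun i => cyclicNetwork N 2 i)
      (by intro j i; simp [usersOf])]
  unfold linearMessage
  rw [Finset.sum_congr rfl fun i _ => sum_encode hN hx i _, Finset.sum_add_distrib, hsum,
    add_zero, map_sum]

variable [Fintype F] [Fintype E]

/-- The linear scheme with inputs in `E × E`, source key in `𝒮` and individual keys `k i s` in `𝒦`.
User `i` masks its input by `c (k i s)` and sends the coordinates of the sum with respect to the
vectors `(1, x j)` of its two relays `j`; every relay adds up what it receives. -/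
noncomputable def linear (x : Fin N → E) (c : 𝒦 →ₗ[F] E × E) (k : Fin N → 𝒮 →ₗ[F] 𝒦)
    {L LZ m : ℕ} (hL : 0 < L) (eW : (Fin L → F) ≃ₗ[F] E × E) (eK : (Fin LZ → F) ≃ₗ[F] 𝒦)
    (eS : (Fin m → F) ≃ₗ[F] 𝒮) : Scheme F (cyclicNetwork N 2) where
  Ω := (Fin N → Fin L → F) × (Fin m → F)
  mΩ := ⊤
  μ := uniformMeasure _
  L := L
  L_pos := hL
  LZ := LZ
  srcLen := m
  MsgX := E
  MsgY := E
  W i ω := ω.1 i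
  Z i ω := eK.symm (k i (eS ω.2))
  src ω := ω.2
  X i j := linearMessage x c k eW eS i j
  Y j := linearRelay x c k eW eS j
  measurable_W _ := fun _ _ => trivial
  measurable_Z _ := fun _ _ => trivial
  measurable_src := fun _ _ => trivial
  measurable_X _ _ := fun _ _ => trivial
  measurable_Y _ := fun _ _ => trivial
  uniform_W w := by
    have h := uniformMeasure_real_preimage_of_surjective
      (AddMonoidHom.fst (Fin N → Fin L → F) (Fin m → F)) Prod.fst_surjective w
    convert h using 1
    · congr 1; ext ω; simp [funext_iff (α := Fin N)]
    · simp [← pow_mul, mul_comm]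
  indep_W_Z w z := by
    have h1 : {ω : (Fin N → Fin L → F) × (Fin m → F) | ∀ i, ω.1 i = w i} =
      {w} ×ˢ Set.univ := by ext ω; simp [funext_iff (α := Fin N)]
    have h2 : {ω : (Fin N → Fin L → F) × (Fin m → F) | ∀ i, eK.symm (k i (eS ω.2)) = z i} =
      Set.univ ×ˢ {s | ∀ i, eK.symm (k i (eS s)) = z i} := by ext ω; simp
    have h3 : {ω : (Fin N → Fin L → F) × (Fin m → F) | (∀ i, ω.1 i = w i) ∧
        ∀ i, eK.symm (k i (eS ω.2)) = z i} =
      {w} ×ˢ {s | ∀ i, eK.symm (k i (eS s)) = z i} := by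
        ext ω; simp [funext_iff (α := Fin N)]
    rw [h1, h2, h3, uniformMeasure_real, uniformMeasure_real, uniformMeasure_real]
    simp only [Nat.card_coe_set_eq, Set.ncard_prod, Set.ncard_singleton, Set.ncard_univ, one_mul]
    simp only [Nat.card_eq_fintype_card, Fintype.card_prod, Nat.cast_mul]
    have hA : (Fintype.card (Fin N → Fin L → F) : ℝ) ≠ 0 := by exact_mod_cast Fintype.card_ne_zero
    have hB : (Fintype.card (Fin m → F) : ℝ) ≠ 0 := by exact_mod_cast Fintype.card_ne_zero
    field_simp
  keys_from_src := by
    let _ : MeasurableSpace ((Fin N → Fin L → F) × (Fin m → F)) := ⊤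
    exact condEntropy_eq_zero_of_forall (one_lt_card F) (fun _ => trivial) (fun _ => trivial)
      fun ω ω' h => by rw [h]
  first_hop i := by
    let _ : MeasurableSpace ((Fin N → Fin L → F) × (Fin m → F)) := ⊤
    refine condEntropy_eq_zero_of_forall (one_lt_card F) (fun _ => trivial) (fun _ => trivial)
      fun ω ω' h => ?_
    simp only [Prod.mk.injEq, EmbeddingLike.apply_eq_iff_eq] at h
    unfold linearMessage
    rw [h.1, h.2]
  second_hop j := by
    let _ : MeasurableSpace ((Fin N → Fin L → F) × (Fin m → F)) := ⊤
    exact condEntropy_eq_zero_of_forall (one_lt_card F) (fun _ => trivial) (fun _ => trivial)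
      fun ω ω' h => Finset.sum_congr rfl fun i hi => congrFun h ⟨i, hi⟩

variable {x : Fin N → E} {c : 𝒦 →ₗ[F] E × E} {k : Fin N → 𝒮 →ₗ[F] 𝒦}
  {L LZ m : ℕ} {hL : 0 < L} {eW : (Fin L → F) ≃ₗ[F] E × E} {eK : (Fin LZ → F) ≃ₗ[F] 𝒦}
  {eS : (Fin m → F) ≃ₗ[F] 𝒮}

lemma isRV_linear {A : Type*} (V : (linear x c k hL eW eK eS).Ω → A) : IsRV V := fun _ => trivial

lemma linear_decodable (hN : 3 ≤ N) (hx : Function.Injective x)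
    (hsum : ∀ s, ∑ i, c (k i s) = 0) : (linear x c k hL eW eK eS).Decodable := by
  refine condEntropy_eq_zero_of_forall (one_lt_card F) (isRV_linear _) (isRV_linear _)
    fun ω ω' h => eW.injective ?_
  refine (map_sum_eq_sum_linearRelay hN hx hsum eW eS ω).trans
    (Eq.trans ?_ (map_sum_eq_sum_linearRelay hN hx hsum eW eS ω').symm)
  have h' : ∀ j, linearRelay x c k eW eS j ω = linearRelay x c k eW eS j ω' := congrFun h
  exact Finset.sum_congr rfl fun j _ => by rw [h']

omit [NeZero N] in
/-- An element of `E` amounts to half an input. -/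
lemma log_card_div_log_eq (eW : (Fin L → F) ≃ₗ[F] E × E) :
    Real.log (Fintype.card E) / Real.log (Fintype.card F) = L / 2 := by
  have h : Fintype.card E * Fintype.card E = Fintype.card F ^ L := by
    rw [← Fintype.card_prod, ← Fintype.card_congr eW.toEquiv]; simp
  have h1 : Real.log (Fintype.card E) + Real.log (Fintype.card E) =
      L * Real.log (Fintype.card F) := by
    have hE : (Fintype.card E : ℝ) ≠ 0 := by exact_mod_cast Fintype.card_ne_zero
    rw [← Real.log_mul hE hE, ← Real.log_pow]
    exact_mod_cast congrArg (fun n : ℕ => Real.log n) h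
  have h2 := Real.log_pos (one_lt_card F)
  rw [div_eq_div_iff h2.ne' (by norm_num)]
  linarith

/-- The security condition for linear keys: the keys of the colluding users and the key parts of
the remaining messages to one relay can take arbitrary values simultaneously. -/
def KeysGeneric (x : Fin N → E) (c : 𝒦 →ₗ[F] E × E) (k : Fin N → 𝒮 →ₗ[F] 𝒦) (T : ℕ) : Prop :=
  ∀ (U : Finset (Fin N)) (j : Fin N), U.card ≤ T → ∀ (z : Fin N → 𝒦) (g : Fin N → E),
    ∃ s, (∀ i ∈ U, k i s = z i) ∧
      ∀ i ∈ usersOf (cyclicNetwork N 2) j, i ∉ U → encode F x i j (c (k i s)) = g i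

/-- Generic keys make the inputs, the keys of the colluding users and the remaining messages to
one relay jointly uniform. -/
lemma H_linear_of_keysGeneric {T : ℕ} (hk : KeysGeneric x c k T) {U : Finset (Fin N)}
    (hU : U.card ≤ T) (j : Fin N) :
    N * L + (U.card * LZ + (usersOf (cyclicNetwork N 2) j \ U).card * (L / 2) : ℝ) =
      (linear x c k hL eW eK eS).H (fun ω => ((linear x c k hL eW eK eS).inputs ω,
        (linear x c k hL eW eK eS).keysOn U ω,
        fun i : ↥(usersOf (cyclicNetwork N 2) j \ U) => (linear x c k hL eW eK eS).X i j ω)) := by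
  set Q := usersOf (cyclicNetwork N 2) j \ U with hQ
  let f : (Fin N → Fin L → F) × (Fin m → F) →+
      (Fin N → Fin L → F) × (U → Fin LZ → F) × (Q → E) :=
    AddMonoidHom.mk' (fun ω => (ω.1, fun i => eK.symm (k i (eS ω.2)),
      fun i => linearMessage x c k eW eS i j ω)) fun ω ω' => by
        simp only [Prod.ext_iff, funext_iff]
        simp [linearMessage]
        intros
        abel
  have hf : Function.Surjective f := by
    classical
    rintro ⟨w, z, g⟩
    obtain ⟨s, hs, hs'⟩ := hk U j hU (fun i => if h : i ∈ U then eK (z ⟨i, h⟩) else 0)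
      fun i => if h : i ∈ Q then g ⟨i, h⟩ - encode F x i j (eW (w i)) else 0
    refine ⟨(w, eS.symm s), ?_⟩
    simp only [f, AddMonoidHom.mk'_apply, Prod.mk.injEq, true_and]
    refine ⟨funext fun i => ?_, funext fun i => ?_⟩
    · simp [hs i i.2]
    · have hi := Finset.mem_sdiff.1 i.2
      have := hs' i hi.1 hi.2
      rw [dif_pos i.2] at this
      simp [linearMessage, this]
  have hE := log_card_div_log_eq eW
  have hF := Real.log_pos (one_lt_card F)
  refine Eq.trans ?_ (entropy_of_uniform (μ := (linear x c k hL eW eK eS).μ)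
    (uniformMeasure_real_preimage_of_surjective f hf)).symm
  have hpos : ∀ (α : Type u) [Fintype α] [Nonempty α], (Fintype.card α : ℝ) ≠ 0 :=
    fun α _ _ => by exact_mod_cast Fintype.card_ne_zero
  simp only [Fintype.card_prod, Fintype.card_fun, Fintype.card_fin, Fintype.card_coe,
    Nat.cast_mul, Nat.cast_pow]
  have hF0 := hpos F
  have hE0 := hpos E
  rw [Real.log_mul (by positivity) (by positivity), Real.log_mul (by positivity) (by positivity)]
  simp only [Real.log_pow]
  rw [add_div, add_div, mul_div_assoc _ _ (Real.log (Fintype.card F)),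
    mul_div_assoc _ (_ * _) (Real.log (Fintype.card F)),
    mul_div_assoc _ (Real.log (Fintype.card E)) _, hE]
  field_simp

/-- Given the view of the colluding users, the other messages to a relay have at most the entropy
of their alphabets; for generic keys they still have that much when all inputs are known too. -/
lemma linear_isSecure (hN : 3 ≤ N) (hx : Function.Injective x)
    (hsum : ∀ s, ∑ i, c (k i s) = 0) {T : ℕ} (hk : KeysGeneric x c k T) :
    (linear x c k hL eW eK eS).IsSecure 1 T := by
  refine ⟨linear_decodable hN hx hsum, fun R U hR hU => ?_⟩
  have hb := one_lt_card F
  set S := linear x c k hL eW eK eS with hS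
  have hrv : ∀ {A : Type u} (V : S.Ω → A), IsRV V := isRV_linear
  -- Submodularity gives that the mutual information is nonnegative, so one inequality remains.
  set M : S.Ω → (j : R) → usersOf (cyclicNetwork N 2) j → S.MsgX := fun ω j i => S.X i j ω
  have hge : S.H (fun ω => (S.inputs ω, M ω, S.view U ω)) - S.H (fun ω => (M ω, S.view U ω)) ≤
      S.H (fun ω => (S.inputs ω, S.view U ω)) - S.H (S.view U) :=
    condEntropy_anti hb (hrv _) (hrv _) (hrv _) (G := Set.univ) (by simp) fun _ _ _ _ h =>
      congrArg Prod.snd h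
  suffices hle : S.H (fun ω => (S.inputs ω, S.view U ω)) - S.H (S.view U) ≤
      S.H (fun ω => (S.inputs ω, M ω, S.view U ω)) - S.H (fun ω => (M ω, S.view U ω)) by
    have : S.H (fun ω => (S.inputs ω, S.view U ω)) - S.H (S.view U) -
      (S.H (fun ω => (S.inputs ω, M ω, S.view U ω)) - S.H (fun ω => (M ω, S.view U ω))) = 0 := by
        linarith
    exact this
  rcases Nat.le_one_iff_eq_zero_or_eq_one.1 hR with h0 | h1
  · obtain rfl := Finset.card_eq_zero.1 h0
    refine condEntropy_anti hb (hrv _) (hrv _) (hrv _) (G := Set.univ) (by simp)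
      fun _ _ _ _ h => Prod.ext (Subsingleton.elim _ _) h
  · obtain ⟨j, rfl⟩ := Finset.card_eq_one.1 h1
    set Q := usersOf (cyclicNetwork N 2) j \ U with hQ
    let MQ : S.Ω → Q → S.MsgX := fun ω i => S.X i j ω
    have e1 : S.H (fun ω => (M ω, S.view U ω)) ≤ S.H (fun ω => (MQ ω, S.view U ω)) := by
      refine entropy_le_of_forall hb (hrv _) fun ω ω' h => ?_
      rw [Prod.mk.injEq] at h ⊢
      refine ⟨?_, h.2⟩
      funext ⟨j', hj'⟩ ⟨i, hi⟩
      obtain rfl := Finset.mem_singleton.1 hj'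
      by_cases hiU : i ∈ U
      · have := view_eq_iff.1 h.2 i hiU
        have hW : ω.1 i = ω'.1 i := this.1
        have hZ : k i (eS ω.2) = k i (eS ω'.2) := eK.symm.injective this.2
        change linearMessage x c k eW eS i j' ω = linearMessage x c k eW eS i j' ω'
        unfold linearMessage
        rw [hW, hZ]
      · exact congrFun h.1 ⟨i, Finset.mem_sdiff.2 ⟨hi, hiU⟩⟩
    have e2 : S.H (fun ω => (MQ ω, S.view U ω)) ≤ S.H MQ + S.H (S.view U) :=
      entropy_prodMk_le hb (hrv _) (hrv _)
    have e3 : S.H MQ ≤ Q.card * (L / 2 : ℝ) := by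
      refine (entropy_le_log_card (A := Q → E) hb (hrv MQ)).trans_eq ?_
      rw [Fintype.card_fun, Fintype.card_coe, Nat.cast_pow, Real.log_pow, mul_div_assoc,
        log_card_div_log_eq eW]
    have e4 : S.H (fun ω => (S.inputs ω, S.keysOn U ω, MQ ω)) ≤
        S.H (fun ω => (S.inputs ω, M ω, S.view U ω)) := by
      refine entropy_le_of_forall hb (hrv _) fun ω ω' h => ?_
      simp only [Prod.mk.injEq, keysOn_eq_iff, view_eq_iff] at h ⊢
      refine ⟨h.1, fun i hi => (h.2.2 i hi).2, funext fun i => ?_⟩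
      exact congrFun (congrFun h.2.1 ⟨j, Finset.mem_singleton_self j⟩)
        ⟨i, (Finset.mem_sdiff.1 i.2).1⟩
    have e5 : _ = S.H (fun ω => (S.inputs ω, S.keysOn U ω, MQ ω)) :=
      H_linear_of_keysGeneric (hL := hL) (eW := eW) (eK := eK) (eS := eS) hk hU j
    have e6 := H_inputs_view (S := S) U
    have e7 : S.H (S.keysOn U) ≤ U.card * LZ := by
      refine (entropy_le_log_card hb (hrv _)).trans_eq ?_
      rw [← Nat.cast_mul]
      exact log_card_div_log F hb (by rw [mul_comm]; simp [← pow_mul]; rfl)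
    have e8 : (S.L : ℝ) = L := rfl
    rw [e8] at e6
    linarith

omit [NeZero N] in
lemma ciSup_le_half {ι : Type*} [Nonempty ι] {f : ι → ℝ} {L : ℕ} (hL : 0 < L)
    (h : ∀ i, f i ≤ (L : ℝ) / 2) : ⨆ i, f i / L ≤ 1 / 2 :=
  ciSup_le fun i => by
    have hL' : (0 : ℝ) < L := by exact_mod_cast hL
    rw [div_le_iff₀ hL']
    linarith [h i]

/-- Generic keys whose masks sum to zero give a communication-optimal secure scheme. -/
lemma linear_isCommOptimalSecure (hN : 3 ≤ N) (hx : Function.Injective x)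
    (hsum : ∀ s, ∑ i, c (k i s) = 0) {T : ℕ} (hk : KeysGeneric x c k T) :
    IsCommOptimalSecure T (linear x c k hL eW eK eS) := by
  have hsec := linear_isSecure (hL := hL) (eW := eW) (eK := eK) (eS := eS) hN hx hsum hk
  set S := linear x c k hL eW eK eS with hS
  have hE : ∀ V : S.Ω → E, S.H V ≤ L / 2 := fun V =>
    (entropy_le_log_card (one_lt_card F) (isRV_linear V)).trans_eq (log_card_div_log_eq eW)
  have : Nonempty {e : Fin N × Fin N // e.2 ∈ cyclicNetwork N 2 e.1} :=
    ⟨⟨(0, 0), self_mem_cyclicNetwork hN 0⟩⟩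
  exact ⟨hsec, (ciSup_le_half hL fun e => hE _).antisymm (half_le_RX hN hsec.1),
    (ciSup_le_half hL fun j => hE _).antisymm (half_le_RY hN hsec.1)⟩

lemma linear_LZSigma_le : (linear x c k hL eW eK eS).LZSigma ≤ m := by
  have hb := one_lt_card F
  set S := linear x c k hL eW eK eS with hS
  have h1 : S.LZSigma ≤ S.H S.src :=
    entropy_le_of_forall hb (isRV_linear _) fun ω ω' h => by
      change ω.2 = ω'.2 at h
      funext i
      change eK.symm (k i (eS ω.2)) = eK.symm (k i (eS ω'.2))
      rw [h]
  refine h1.trans ((entropy_le_log_card hb (isRV_linear _)).trans_eq ?_)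
  exact log_card_div_log F hb (by simp; rfl)

end Linear

/-! ### Generic keys attaining the lower bounds -/

section Keys

variable {F : Type u} [Field F] {N : ℕ} [NeZero N] {E : Type u} [Field E] [Algebra F E]

lemma sub_otherRelay_ne_zero (hN : 3 ≤ N) {x : Fin N → E} (hx : Function.Injective x)
    {i j : Fin N} (hj : j ∈ cyclicNetwork N 2 i) : x j - x (otherRelay i j) ≠ 0 := by
  rw [sub_ne_zero]
  refine fun h => ?_
  have h := hx h
  have hne := sub_one_ne hN i
  unfold otherRelay at h
  rcases (mem_cyclicNetwork_two hN).1 hj with rfl | rfl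
  · rw [if_pos rfl] at h
    exact hne h.symm
  · rw [if_neg hne] at h
    exact hne h

lemma encode_zero_mul (hN : 3 ≤ N) {x : Fin N → E} (hx : Function.Injective x)
    {i j : Fin N} (hj : j ∈ cyclicNetwork N 2 i) (g : E) :
    encode F x i j (0, (x j - x (otherRelay i j)) * g) = g := by
  have := sub_otherRelay_ne_zero hN hx hj
  rw [encode_apply]
  field_simp
  ring

lemma mem_usersOf_cyclicNetwork (hN : 3 ≤ N) {i j : Fin N} :
    i ∈ usersOf (cyclicNetwork N 2) j ↔ i = j ∨ i = j + 1 := by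
  simp only [usersOf, Finset.mem_filter, Finset.mem_univ, true_and, mem_cyclicNetwork_two hN,
    eq_sub_iff_add_eq, eq_comm]

omit [NeZero N] in
lemma mem_cyclicNetwork_of_mem_usersOf {i j : Fin N} (h : i ∈ usersOf (cyclicNetwork N 2) j) :
    j ∈ cyclicNetwork N 2 i := by
  simpa [usersOf] using h

/-! ### One key symbol per user, from a Reed–Solomon code -/

/-- The `i`-th coordinate of the generalized Reed–Solomon code of dimension `d` with nodes `x` and
with multipliers such that all codewords have coordinate sum zero (as long as `d < N`). -/
noncomputable def reedSolomonKey (F : Type u) [Field F] [Algebra F E] (x : Fin N → E) (d : ℕ)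
    (i : Fin N) : (Fin d → E) →ₗ[F] E :=
  (((∏ j ∈ Finset.univ.erase i, (x i - x j))⁻¹ • Polynomial.leval (x i)) ∘ₗ
    (Polynomial.degreeLT E d).subtype ∘ₗ
      (Polynomial.degreeLTEquiv E d).symm.toLinearMap).restrictScalars F

omit [NeZero N] in
lemma reedSolomonKey_apply (x : Fin N → E) (d : ℕ) (i : Fin N) (s : Fin d → E) :
    reedSolomonKey F x d i s = (∏ j ∈ Finset.univ.erase i, (x i - x j))⁻¹ *
      (((Polynomial.degreeLTEquiv E d).symm s : Polynomial E)).eval (x i) := rfl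

omit [NeZero N] in
/-- The sum of the coordinates is the leading coefficient in Lagrange interpolation. -/
lemma sum_reedSolomonKey {x : Fin N → E} (hx : Function.Injective x) {d : ℕ} (hd : d < N)
    (s : Fin d → E) : ∑ i, reedSolomonKey F x d i s = 0 := by
  set p : Polynomial E := ((Polynomial.degreeLTEquiv E d).symm s : Polynomial E) with hp
  have hdeg : p.degree < d := Polynomial.mem_degreeLT.1 ((Polynomial.degreeLTEquiv E d).symm s).2
  have h := Lagrange.coeff_eq_sum (s := Finset.univ) (v := x) hx.injOn (P := p)
    (hdeg.trans (by simpa using hd))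
  rw [Polynomial.coeff_eq_zero_of_degree_lt (hdeg.trans_le (by simp; omega))] at h
  rw [h]
  exact Finset.sum_congr rfl fun i _ => by rw [reedSolomonKey_apply, div_eq_inv_mul]

omit [NeZero N] in
/-- Any `d` coordinates of the code can be prescribed. -/
lemma exists_reedSolomonKey_eq {x : Fin N → E} (hx : Function.Injective x) {d : ℕ}
    {V : Finset (Fin N)} (hV : V.card ≤ d) (t : Fin N → E) :
    ∃ s, ∀ i ∈ V, reedSolomonKey F x d i s = t i := by
  set p := Lagrange.interpolate V x fun i => (∏ j ∈ Finset.univ.erase i, (x i - x j)) * t i with hp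
  have hdeg : p ∈ Polynomial.degreeLT E d := Polynomial.mem_degreeLT.2
    ((Lagrange.degree_interpolate_lt _ hx.injOn).trans_le (by exact_mod_cast hV))
  refine ⟨Polynomial.degreeLTEquiv E d ⟨p, hdeg⟩, fun i hi => ?_⟩
  rw [reedSolomonKey_apply, LinearEquiv.symm_apply_apply]
  simp only [hp]
  rw [Lagrange.eval_interpolate_at_node _ hx.injOn hi, inv_mul_cancel_left₀]
  refine Finset.prod_ne_zero_iff.2 fun j hj => sub_ne_zero.2 fun h => ?_
  exact (Finset.mem_erase.1 hj).1 (hx h).symm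

/-- The colluding users and the users of one relay are at most `T + 2` users in total. -/
lemma keysGeneric_reedSolomonKey (hN : 3 ≤ N) {x : Fin N → E} (hx : Function.Injective x) (T : ℕ) :
    KeysGeneric x (LinearMap.inr F E E) (reedSolomonKey F x (T + 2)) T := by
  intro U j hU z g
  have hV : (U ∪ usersOf (cyclicNetwork N 2) j).card ≤ T + 2 := by
    have h1 : usersOf (cyclicNetwork N 2) j ⊆ {j, j + 1} := fun i hi => by
      simpa using (mem_usersOf_cyclicNetwork hN).1 hi
    have h2 := (Finset.card_le_card h1).trans Finset.card_le_two
    have h3 := Finset.card_union_le U (usersOf (cyclicNetwork N 2) j)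
    omega
  obtain ⟨s, hs⟩ := exists_reedSolomonKey_eq (F := F) hx hV
    fun i => if i ∈ U then z i else (x j - x (otherRelay i j)) * g i
  refine ⟨s, fun i hi => ?_, fun i hi hiU => ?_⟩
  · rw [hs i (Finset.mem_union_left _ hi), if_pos hi]
  · rw [hs i (Finset.mem_union_right _ hi), if_neg hiU]
    exact encode_zero_mul hN hx (mem_cyclicNetwork_of_mem_usersOf hi) (g i)

/-! ### Two key symbols per user, with sum zero -/

/-- The sum of all key vectors. -/
def sumKeys (F : Type u) [Field F] (N : ℕ) (E : Type u) [Field E] [Algebra F E] :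
    (Fin N → E × E) →ₗ[F] E × E := ∑ i, LinearMap.proj i

omit [NeZero N] in
lemma sumKeys_apply (K : Fin N → E × E) : sumKeys F N E K = ∑ i, K i := by
  simp [sumKeys]

/-- The key vector of user `i`, when the keys are arbitrary vectors with sum zero. -/
def zeroSumKey (F : Type u) [Field F] (E : Type u) [Field E] [Algebra F E] (i : Fin N) :
    LinearMap.ker (sumKeys F N E) →ₗ[F] E × E :=
  LinearMap.proj i ∘ₗ (LinearMap.ker (sumKeys F N E)).subtype

/-- If at least two users are outside `U`, key vectors outside `U` that are invisible to relay `j`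
can have any sum: this is clear if a user outside `U` is not connected to relay `j`; otherwise the
users `j` and `j + 1` are outside `U`, and the kernels of their messages are spanned by
`(1, x (j - 1))` and `(1, x (j + 1))`, which form a basis. -/
lemma exists_invisible_sum_eq (hN : 3 ≤ N) {x : Fin N → E} (hx : Function.Injective x)
    {U : Finset (Fin N)} (hU : U.card + 2 ≤ N) (j : Fin N) (v : E × E) :
    ∃ δ : Fin N → E × E, (∀ i ∈ U, δ i = 0) ∧
      (∀ i ∈ usersOf (cyclicNetwork N 2) j, encode F x i j (δ i) = 0) ∧ ∑ i, δ i = v := by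
  by_cases h : ∃ a, a ∉ U ∧ a ∉ usersOf (cyclicNetwork N 2) j
  · obtain ⟨a, haU, haj⟩ := h
    refine ⟨Pi.single a v, fun i hi => ?_, fun i hi => ?_, by simp⟩
    · exact Pi.single_eq_of_ne (ne_of_mem_of_not_mem hi haU) _
    · rw [Pi.single_eq_of_ne (ne_of_mem_of_not_mem hi haj), map_zero]
  · have hsub : Uᶜ ⊆ {j, j + 1} := fun i hi => by
      by_contra hi'
      exact h ⟨i, Finset.mem_compl.1 hi, fun hm => hi' (by
        simpa using (mem_usersOf_cyclicNetwork hN).1 hm)⟩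
    have hcard : ({j, j + 1} : Finset (Fin N)).card ≤ Uᶜ.card := by
      have := Finset.card_compl U
      rw [Fintype.card_fin] at this
      have := Finset.card_le_two (a := j) (b := j + 1)
      omega
    have hUc := Finset.eq_of_subset_of_card_le hsub hcard
    have hj : j ∉ U := by rw [← Finset.mem_compl, hUc]; simp
    have hj' : j + 1 ∉ U := by rw [← Finset.mem_compl, hUc]; simp
    have hne : j + 1 ≠ j := fun h => sub_one_ne hN (j + 1) (by rw [add_sub_cancel_right, h])
    have hne2 : j - 1 ≠ j + 1 := by
      intro h
      have h2 : (1 : Fin N) + 1 = 0 := by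
        have h3 : j - 1 + 1 = j + 1 + 1 := by rw [h]
        rw [sub_add_cancel, add_assoc] at h3
        exact left_eq_add.1 h3
      have h1 := val_one_of_two_le (N := N) (by omega)
      have h4 := congrArg Fin.val h2
      rw [Fin.val_add, h1, Nat.mod_eq_of_lt (by omega)] at h4
      simp at h4
    have hd : x (j + 1) - x (j - 1) ≠ 0 := sub_ne_zero.2 fun h => hne2 (hx h).symm
    set a := (x (j + 1) * v.1 - v.2) / (x (j + 1) - x (j - 1)) with ha
    set b := (v.2 - x (j - 1) * v.1) / (x (j + 1) - x (j - 1)) with hb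
    refine ⟨Pi.single j (a, x (j - 1) * a) + Pi.single (j + 1) (b, x (j + 1) * b),
      fun i hi => ?_, fun i hi => ?_, ?_⟩
    · rw [Pi.add_apply, Pi.single_eq_of_ne (ne_of_mem_of_not_mem hi hj),
        Pi.single_eq_of_ne (ne_of_mem_of_not_mem hi hj'), add_zero]
    · rcases (mem_usersOf_cyclicNetwork hN).1 hi with rfl | rfl
      · rw [Pi.add_apply, Pi.single_eq_same, Pi.single_eq_of_ne hne.symm, add_zero, encode_apply,
          otherRelay, if_pos rfl]
        simp
      · rw [Pi.add_apply, Pi.single_eq_same, Pi.single_eq_of_ne hne, zero_add, encode_apply,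
          otherRelay, if_neg hne.symm]
        simp
    · simp only [Pi.add_apply, Finset.sum_add_distrib, Finset.sum_pi_single', Finset.mem_univ,
        if_true]
      ext
      · simp only [Prod.fst_add, ha, hb]
        field_simp
        ring
      · simp only [Prod.snd_add, ha, hb]
        field_simp
        ring

lemma keysGeneric_zeroSumKey (hN : 3 ≤ N) {x : Fin N → E} (hx : Function.Injective x) {T : ℕ}
    (hT : T + 2 ≤ N) : KeysGeneric x LinearMap.id (zeroSumKey F E) T := by
  intro U j hU z g
  set K : Fin N → E × E := fun i => if i ∈ U then z i else (0, (x j - x (otherRelay i j)) * g i)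
    with hK
  obtain ⟨δ, hδU, hδj, hδ⟩ := exists_invisible_sum_eq (F := F) hN hx (U := U) (by omega) j
    (-∑ i, K i)
  refine ⟨⟨K + δ, ?_⟩, fun i hi => ?_, fun i hi hiU => ?_⟩
  · rw [LinearMap.mem_ker, sumKeys_apply]
    simp only [Pi.add_apply, Finset.sum_add_distrib, hδ, add_neg_cancel]
  · change K i + δ i = z i
    rw [hδU i hi, add_zero, hK]
    exact if_pos hi
  · change encode F x i j (K i + δ i) = g i
    rw [map_add, hδj i hi, add_zero, hK]
    simp only [if_neg hiU]
    exact encode_zero_mul hN hx (mem_cyclicNetwork_of_mem_usersOf hi) (g i)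

omit [NeZero N] in
lemma finrank_ker_sumKeys [Fintype F] [Fintype E] (hN : 1 ≤ N) :
    Module.finrank F (LinearMap.ker (sumKeys F N E)) =
      (N - 1) * (Module.finrank F E + Module.finrank F E) := by
  have hsurj : LinearMap.range (sumKeys F N E) = ⊤ := by
    refine LinearMap.range_eq_top.2 fun v => ⟨Pi.single ⟨0, hN⟩ v, ?_⟩
    rw [sumKeys_apply]
    simp
  have h := LinearMap.finrank_range_add_finrank_ker (sumKeys F N E)
  rw [hsurj, finrank_top, Module.finrank_pi_fintype] at h
  simp only [Module.finrank_prod, Finset.sum_const, Finset.card_univ, Fintype.card_fin,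
    smul_eq_mul] at h
  rw [Nat.sub_mul, one_mul]
  omega

end Keys

/-! ### Optimal key rates -/

/-- A finite field has finite extensions of arbitrarily large size. -/
lemma exists_finite_extension (F : Type u) [Field F] [Fintype F] (N : ℕ) :
    ∃ (E : Type u) (_ : Field E) (_ : Fintype E) (_ : Algebra F E),
      ∃ x : Fin N → E, Function.Injective x := by
  obtain ⟨s, hs⟩ := Infinite.exists_subset_card_eq (AlgebraicClosure F) N
  have : FiniteDimensional F (IntermediateField.adjoin F (s : Set (AlgebraicClosure F))) :=
    IntermediateField.finiteDimensional_adjoin fun a _ => Algebra.IsIntegral.isIntegral a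
  have : Finite (IntermediateField.adjoin F (s : Set (AlgebraicClosure F))) :=
    Module.finite_of_finite F
  refine ⟨IntermediateField.adjoin F (s : Set (AlgebraicClosure F)), inferInstance,
    Fintype.ofFinite _, inferInstance, fun i =>
      ⟨s.equivFin.symm (Fin.cast hs.symm i), IntermediateField.subset_adjoin _ _ (by simp)⟩, ?_⟩
  intro i i' h
  simpa [Subtype.ext_iff] using h

/-- Generic keys whose key and source lengths match the lower bounds attain the optimal rates. That
the source key has no redundancy follows from the lower bound on `H(Z_1, …, Z_N)`. -/
lemma optimalKeyRates_of_linear {F : Type u} [Field F] [Fintype F] {N T : ℕ} [NeZero N]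
    (hN : 3 ≤ N) {rZ rSigma : ℝ}
    (hlower : ∀ S : Scheme F (cyclicNetwork N 2), IsCommOptimalSecure T S →
      rZ ≤ S.RZ ∧ rSigma ≤ S.RZSigma)
    {E 𝒮 𝒦 : Type u} [Field E] [Fintype E] [Algebra F E] [AddCommGroup 𝒮] [Module F 𝒮]
    [Module.Finite F 𝒮] [AddCommGroup 𝒦] [Module F 𝒦] [Module.Finite F 𝒦]
    {x : Fin N → E} (hx : Function.Injective x) {c : 𝒦 →ₗ[F] E × E} {k : Fin N → 𝒮 →ₗ[F] 𝒦}
    (hsum : ∀ s, ∑ i, c (k i s) = 0) (hk : KeysGeneric x c k T)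
    (hrZ : (Module.finrank F 𝒦 : ℝ) = rZ * (2 * Module.finrank F E))
    (hrSigma : (Module.finrank F 𝒮 : ℝ) = rSigma * (2 * Module.finrank F E)) :
    OptimalKeyRates F N T rZ rSigma := by
  refine ⟨hlower, ?_⟩
  have hpos : 0 < 2 * Module.finrank F E := by
    have : 0 < Module.finrank F E := Module.finrank_pos
    omega
  let eW : (Fin (2 * Module.finrank F E) → F) ≃ₗ[F] E × E :=
    LinearEquiv.ofFinrankEq _ _ (by simp [two_mul])
  let eK : (Fin (Module.finrank F 𝒦) → F) ≃ₗ[F] 𝒦 := LinearEquiv.ofFinrankEq _ _ (by simp)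
  let eS : (Fin (Module.finrank F 𝒮) → F) ≃ₗ[F] 𝒮 := LinearEquiv.ofFinrankEq _ _ (by simp)
  have hS := linear_isCommOptimalSecure (hL := hpos) (eW := eW) (eK := eK) (eS := eS)
    hN hx hsum hk
  have hle := linear_LZSigma_le (hL := hpos) (x := x) (c := c) (k := k) (eW := eW) (eK := eK)
    (eS := eS)
  set S := linear x c k hpos eW eK eS with hS'
  have hL : (S.L : ℝ) = 2 * Module.finrank F E := by
    change ((2 * Module.finrank F E : ℕ) : ℝ) = _
    push_cast
    rfl
  have hLZ : S.LZ = Module.finrank F 𝒦 := rfl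
  have hsrc : S.srcLen = Module.finrank F 𝒮 := rfl
  have hL0 := L_pos_real S
  have hge := (hlower S hS).2
  rw [RZSigma, le_div_iff₀ hL0, hL, ← hrSigma] at hge
  have heq := hle.antisymm hge
  refine ⟨S, hS, ?_, ?_, ?_⟩
  · rw [SourceKeyExact, hsrc, heq]
  · rw [RZ, div_eq_iff hL0.ne', hLZ, hL, hrZ]
  · rw [RZSigma, div_eq_iff hL0.ne', heq, hL, hrSigma]

end Scheme
end HSA

theorem mainTheorem8 {F : Type u} [Field F] [Fintype F] (N T : ℕ) (hN : 3 ≤ N) :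
    (∀ S : HSA.Scheme F (HSA.cyclicNetwork N 2), S.IsSecure 1 T →
      1 / 2 ≤ S.RX ∧ 1 / 2 ≤ S.RY) ∧
    (T + 3 ≤ N → HSA.OptimalKeyRates F N T (1 / 2) ((T : ℝ) / 2 + 1)) ∧
    (T + 2 = N → HSA.OptimalKeyRates F N T 1 ((N : ℝ) - 1)) ∧
    (N ≤ T + 1 → ¬ ∃ S : HSA.Scheme F (HSA.cyclicNetwork N 2), HSA.IsCommOptimalSecure T S) := by
  open HSA Scheme in
  have : NeZero N := ⟨by omega⟩
  obtain ⟨E, _, _, _, x, hx⟩ := exists_finite_extension F N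
  refine ⟨fun S hS => ⟨half_le_RX hN hS.1, half_le_RY hN hS.1⟩, fun hT => ?_, fun hT => ?_, ?_⟩
  · refine optimalKeyRates_of_linear hN (fun S hS => key_rates_of_le hN hT hS) hx
      (fun s => ?_) (keysGeneric_reedSolomonKey hN hx T) (by ring) ?_
    · rw [← map_sum, sum_reedSolomonKey hx (by omega), map_zero]
    · rw [Module.finrank_pi_fintype]
      simp
      ring
  · refine optimalKeyRates_of_linear hN (fun S hS => key_rates_of_eq hN hT hS) hx
      (fun s => ?_) (keysGeneric_zeroSumKey hN hx hT.le) ?_ ?_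
    · exact (sumKeys_apply _).symm.trans s.2
    · rw [Module.finrank_prod]
      push_cast
      ring
    · rw [finrank_ker_sumKeys (by omega), Nat.cast_mul, Nat.cast_sub (by omega)]
      push_cast
      ring
  · rintro hT ⟨S, hS, hX, -⟩
    exact not_isSecure_of_le hN hT hS hX
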